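/- Let $(\sigma(k))_{k\in\mathbb Z}$ be complex numbers with $\sigma(-k)=\overline{\sigma(k)}$ and $\sum_k|\sigma(k)|^2<\infty$. Let $s(\omega)=\sum_{k\in\mathbb Z}\sigma(k)e^{-\mathrm{j}k\omega}$ (convergence in $L^2(0,2\pi)$), assume $\operatorname{ess\,inf} s>0$, and put $\Lambda=\frac1{2\pi}\int_0^{2\pi}\frac{d\omega}{\sqrt{s(\omega)}}$. Let $\sigma_\xi^2>0$ be the noise power and $\eta=1/\sigma_\xi^2$. Fix $\beta>1$ and let $(N_t,N_r)$ run through a sequence of pairs of positive integers with $N_t$ strictly increasing and $N_r=\beta N_t$. For each such $N_t$ let $\mathbf\Sigma=[\sigma(m-n)]_{m,n=1}^{N_t}$ have an eigenvalue decomposition $\mathbf\Sigma=\mathbf W\,\mathrm{diag}(\lambda_1,\dots,\lambda_{N_t})\,\mathbf W^H$ with $\mathbf W$ unitary and $\lambda_1\le\dots\le\lambda_{N_t}$, and let the optimal precoder be $$\widetilde{\mathbf F}=\frac1{\sqrt{\sum_m\lambda_m^{-1/2}}}\;\mathbf W\,\mathrm{diag}(\lambda_1^{-1/4},\dots,\lambda_{N_t}^{-1/4})\,\mathbf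 V,$$ where $\mathbf V$ is the normalized $N_t\times N_t$ DFT matrix. Let the channel $\mathbf H$ be a zero-mean circularly-symmetric complex Gaussian $N_r\times N_t$ random matrix with covariance $\mathbf I\otimes\mathbf\Sigma$: its rows $\mathbf h_\ell^T$ satisfy $\mathbb E[(\mathbf h_\ell^T)^H\mathbf h_m^T]=\mathbf\Sigma$ if $\ell=m$ and $\mathbf 0$ otherwise. The channels for different $N_t$ are defined on one probability space, with arbitrary dependence between them. For $k\in\{1,\dots,N_t\}$ let the instantaneous SNR of sub-channel $k$ after zero-forcing equalization be $$\tau_k=\frac1{\sigma_\xi^2\,\big[(\widetilde{\mathbf F}^H\mathbf H^H\mathbf H\widetilde{\mathbf F})^{-1}\big]_{kk}}.$$ Then, for every choice of sub-channels $k=k(N_t)\in\{1,\dots,N_t\}$, as $N_t\to\infty$, $$\tau_k\to\frac{\eta(\beta-1)}{\Lambda^2}\quad\text{almost surely}.$$ Moreover every $\tau_k$ has a finite second moment, and $\mathbb E[\tau_k]\to\frac{\eta(\beta-1)}{\Lambda^2}$ and $\operatorname{Var}[\tau_k]\to0$. -/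

import Mathlib

open MeasureTheory ProbabilityTheory Filter Topology

/-- The `N × N` Toeplitz covariance matrix whose `(m, n)` entry is `σ (m - n)`. -/
def toeplitzCov (σ : ℤ → ℂ) (N : ℕ) : Matrix (Fin N) (Fin N) ℂ :=
  Matrix.of fun m n => σ ((m : ℤ) - (n : ℤ))

instance factTwoPiPos : Fact (0 < 2 * Real.pi) := ⟨Real.two_pi_pos⟩

/-- The Fourier series `∑ₖ σ(k) e^{-ikω}`, summed in `L²` of the circle `ℝ / 2πℤ`
(for square-summable `σ` it converges there; `fourierLp 2 (-k)` is the class of `e^{-ikω}`). -/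
noncomputable def fourierSeriesL2 (σ : ℤ → ℂ) :
    Lp ℂ 2 (@AddCircle.haarAddCircle (2 * Real.pi) _) :=
  ∑' k : ℤ, σ k • fourierLp 2 (-k)

/-- The spectral density `s(ω) = ∑ₖ σ(k) e^{-ikω}`. It is determined up to a null set, and it is
real almost everywhere when `σ(-k)` is the conjugate of `σ(k)`. -/
noncomputable def spectralDensity (σ : ℤ → ℂ) (ω : ℝ) : ℝ :=
  (fourierSeriesL2 σ (ω : AddCircle (2 * Real.pi))).re

/-- The essential infimum of the spectral density over one period. -/
noncomputable def spectralEssInf (σ : ℤ → ℂ) : ℝ :=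
  essInf (spectralDensity σ) (volume.restrict (Set.Ioc 0 (2 * Real.pi)))

/-- `Λ = (1 / 2π) ∫₀^{2π} dω / √(s(ω))`. -/
noncomputable def spectralLambda (σ : ℤ → ℂ) : ℝ :=
  1 / (2 * Real.pi) * ∫ ω in (0 : ℝ)..(2 * Real.pi), 1 / Real.sqrt (spectralDensity σ ω)

/-- `S = W diag(lam) Wᴴ` with `W` unitary and eigenvalues in increasing order. -/
structure IsEigenDecomp {N : ℕ} (S W : Matrix (Fin N) (Fin N) ℂ) (lam : Fin N → ℝ) : Prop where
  unitary : W ∈ Matrix.unitaryGroup (Fin N) ℂ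
  mono : Monotone lam
  eq : S = W * Matrix.diagonal (fun i => (lam i : ℂ)) * W.conjTranspose

/-- The normalized `N × N` DFT matrix. -/
noncomputable def dftMatrix (N : ℕ) : Matrix (Fin N) (Fin N) ℂ :=
  Matrix.of fun j k =>
    ((1 / Real.sqrt N : ℝ) : ℂ) *
      Complex.exp (-(2 * Real.pi * Complex.I * ((j : ℕ) : ℂ) * ((k : ℕ) : ℂ) / (N : ℂ)))

/-- The optimal precoder `(tr Λ^{-1/2})^{-1/2} W Λ^{-1/4} V`, where `Λ = diag(lam)` and `V` is the
normalized DFT matrix. -/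
noncomputable def optimalPrecoder {N : ℕ} (W : Matrix (Fin N) (Fin N) ℂ) (lam : Fin N → ℝ) :
    Matrix (Fin N) (Fin N) ℂ :=
  ((1 / Real.sqrt (∑ i, lam i ^ (-(1 / 2) : ℝ)) : ℝ) : ℂ) •
    (W * Matrix.diagonal (fun i => ((lam i ^ (-(1 / 4) : ℝ) : ℝ) : ℂ)) * dftMatrix N)

/-- The random `R × N` matrix `H` is a zero-mean circularly-symmetric complex Gaussian matrix with
covariance `I ⊗ S`: its entries are jointly Gaussian, rows are uncorrelated, and each row `h` has
`E[hᴴ h] = S` and `E[hᵀ h] = 0`. -/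
structure IsGaussianChannel {Ω : Type*} [MeasurableSpace Ω] (P : Measure Ω) {R N : ℕ}
    (S : Matrix (Fin N) (Fin N) ℂ) (H : Ω → Matrix (Fin R) (Fin N) ℂ) : Prop where
  gaussian : HasGaussianLaw (fun ω (p : Fin R × Fin N) => H ω p.1 p.2) P
  mean_zero : ∀ l i, ∫ ω, H ω l i ∂P = 0
  cov : ∀ l m i j, ∫ ω, star (H ω l i) * H ω m j ∂P = if l = m then S i j else 0
  pseudoCov : ∀ l m i j, ∫ ω, H ω l i * H ω m j ∂P = 0

/-- The instantaneous SNR of sub-channel `k` after zero-forcing equalization, for noise power `v`,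
channel `H` and precoder `F`: `1 / (v [(Fᴴ Hᴴ H F)⁻¹]ₖₖ)`. -/
noncomputable def zfSNR {R N : ℕ} (v : ℝ) (H : Matrix (Fin R) (Fin N) ℂ)
    (F : Matrix (Fin N) (Fin N) ℂ) (k : Fin N) : ℝ :=
  1 / (v * ((F.conjTranspose * H.conjTranspose * H * F)⁻¹ k k).re)

/-!
The precoded Gram matrix is `Fᴴ Hᴴ H F`, where the channel `H` has row covariance
`S = W diag(λ) Wᴴ`. Write `F T = M` with `M` whitening, `Mᴴ S M = 1`, and `T` invertible. Any unitary
factor in `T` is free, and it can be chosen so that the `k`-th row of `T` is a multiple of the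
`k`-th unit vector; then the `k`-th diagonal entry of `(Fᴴ Hᴴ H F)⁻¹` is a constant times that of
`(Gᴴ G)⁻¹`, where `G = H M` has independent standard entries. Because all entries of the DFT matrix
have modulus `N^{-1/2}`, the constant does not depend on `k`, and
`τ = η N / (∑ λᵢ^{-1/2})² · Y` with `Y = 1 / [(Gᴴ G)⁻¹]ₖₖ` (`exists_whitening_optimalPrecoder`).

The variable `Y` is the squared distance of the `k`-th column of `G` to the span of the other
`N - 1` columns. These are independent of it and almost surely linearly independent, so by unitary
invariance `Y` is a sum of `R - N + 1` independent variables `|x|²` with `x` standard complex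
Gaussian (`hasLaw_invGramDiag`). Its mean is `R - N + 1`, its variance and its fourth central moment
are of first and second order in `R - N + 1` (`exists_moments_complexChiSq`).

The normalization is governed by Szegő's theorem: `(1/N) ∑ λᵢ^{-1/2}` tends to `Λ`
(`tendsto_average_rpow_neg_half`). For a symbol in `L²` bounded below by `δ > 0` this has a short
proof. The spectrum lies in `[δ, ∞)`, where `x^{-1/2}` is Lipschitz; up to a small multiple of `√N`
in Frobenius norm, the Toeplitz matrix is banded, and the discrete Fourier basis diagonalizes banded
Toeplitz matrices up to boundary rows; and Frobenius-close matrices have close averages of Lipschitz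
functions over their spectra (`IsEigenDecomp.abs_sum_sub_sum_le`). The averages over the approximate
eigenvalues are Riemann sums.

Hence `E τ` converges to `η (β - 1) / Λ²`, `Var τ = O(1/N)` and `E (τ - E τ)⁴ = O(1/N²)`. The last
bound is summable, which gives almost sure convergence without any assumption on the joint law of
the channels (`tendsto_mul_of_hasLaw_complexChiSq`).
-/

/-! ### Gram matrices and distances to subspaces -/

section Gram

variable {E : Type*} [NormedAddCommGroup E] [InnerProductSpace ℂ E] [FiniteDimensional ℂ E]

/-- A diagonal entry of the inverse Gram matrix is the inverse squared distance of one vector to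
the span of the others. If the whole family is dependent, both sides vanish, the left one because
the inverse of a singular matrix is `0` and `1 / 0 = 0`. -/
theorem one_div_gram_inv_apply_re {n : ℕ} (i : Fin (n + 1)) (a : Fin (n + 1) → E)
    (hli : LinearIndependent ℂ (fun j => a (i.succAbove j))) :
    1 / ((Matrix.gram ℂ a)⁻¹ i i).re =
      ‖(Submodule.span ℂ (Set.range fun j => a (i.succAbove j)))ᗮ.starProjection (a i)‖ ^ 2 := by
  set K := Submodule.span ℂ (Set.range fun j => a (i.succAbove j)) with hK
  have hmem : ∀ j, j ≠ i → a j ∈ K := by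
    intro j hj
    obtain ⟨l, rfl⟩ := Fin.exists_succAbove_eq hj
    exact Submodule.subset_span ⟨l, rfl⟩
  have hproj : ∀ x ∈ K, Kᗮ.starProjection x = 0 := by
    intro x hx
    rw [Submodule.starProjection_apply_eq_zero_iff]
    exact Submodule.le_orthogonal_orthogonal K hx
  by_cases hdet : (Matrix.gram ℂ a).det = 0
  · have hdep : ¬ LinearIndependent ℂ a := fun h =>
      (Matrix.det_gram_ne_zero_iff_linearIndependent.2 h) hdet
    have hi : a i ∈ K := by
      by_contra hcon
      apply hdep
      rw [← linearIndependent_equiv (finSuccEquiv' i).symm, linearIndependent_option]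
      simpa [Function.comp_def] using ⟨hli, hcon⟩
    rw [Matrix.nonsing_inv_apply_not_isUnit _ (by simpa using hdet), hproj _ hi]
    simp
  · have hunit : IsUnit (Matrix.gram ℂ a).det := by simpa using hdet
    set c : Fin (n + 1) → ℂ := fun j => (Matrix.gram ℂ a)⁻¹ j i with hc
    set w : E := ∑ j, c j • a j with hw
    have hinner : ∀ l, inner ℂ (a l) w = if l = i then 1 else 0 := by
      intro l
      have := congrFun (congrFun (Matrix.mul_nonsing_inv _ hunit) l) i
      rw [Matrix.mul_apply, Matrix.one_apply] at this
      rw [← this, hw, inner_sum]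
      refine Finset.sum_congr rfl fun j _ => ?_
      rw [inner_smul_right, Matrix.gram_apply, mul_comm]
    have hwK : w ∈ Kᗮ := by
      rw [Submodule.mem_orthogonal]
      intro u hu
      induction hu using Submodule.span_induction with
      | mem x hx =>
        obtain ⟨j, rfl⟩ := hx
        simpa using hinner (i.succAbove j)
      | zero => simp
      | add x y _ _ hx hy => rw [inner_add_left, hx, hy, add_zero]
      | smul r x _ hx => rw [inner_smul_left, hx, mul_zero]
    have hPw : w = c i • Kᗮ.starProjection (a i) := by
      conv_lhs => rw [← Submodule.starProjection_eq_self_iff.2 hwK, hw, map_sum]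
      rw [Finset.sum_eq_single i]
      · rw [map_smul]
      · intro j _ hj
        rw [map_smul, hproj _ (hmem j hj), smul_zero]
      · simp
    have h1 : inner ℂ (a i) w = 1 := by simpa using hinner i
    have h3 : inner ℂ (a i) (Kᗮ.starProjection (a i)) =
        ((‖Kᗮ.starProjection (a i)‖ ^ 2 : ℝ) : ℂ) := by
      rw [← Submodule.starProjection_eq_self_iff.2 (Kᗮ.starProjection_apply_mem (a i)),
        ← Submodule.inner_starProjection_left_eq_right,
        Submodule.starProjection_eq_self_iff.2 (Kᗮ.starProjection_apply_mem (a i)),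
        inner_self_eq_norm_sq_to_K]
      simp
    have h2 : c i * ((‖Kᗮ.starProjection (a i)‖ ^ 2 : ℝ) : ℂ) = 1 := by
      rw [← h1, hPw, inner_smul_right, h3]
    have h4 : c i = (((‖Kᗮ.starProjection (a i)‖ ^ 2)⁻¹ : ℝ) : ℂ) := by
      rw [eq_inv_of_mul_eq_one_left h2]
      simp
    change 1 / (c i).re = _
    rw [h4, Complex.ofReal_re, one_div, inv_inv]

/-- With all vectors but the `i`-th one fixed and independent, the inverse of the `i`-th diagonal
entry of the inverse Gram matrix is a sum of `dim E - n` squared coordinates of the `i`-th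
vector, along an orthonormal family that depends on the fixed vectors only. -/
theorem exists_orthonormal_one_div_gram_inv {n d : ℕ} (hd : n + d = Module.finrank ℂ E)
    (i : Fin (n + 1)) (a : Fin n → E) (hli : LinearIndependent ℂ a) :
    ∃ e : Fin d → E, Orthonormal ℂ e ∧ ∀ b : E,
      1 / ((Matrix.gram ℂ (i.insertNth b a : Fin (n + 1) → E))⁻¹ i i).re =
        ∑ j, ‖inner ℂ (e j) b‖ ^ 2 := by
  set K := Submodule.span ℂ (Set.range a) with hK
  have hfin : Module.finrank ℂ Kᗮ = d := by
    have h1 := K.finrank_add_finrank_orthogonal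
    have h2 : Module.finrank ℂ K = n := by
      rw [hK, finrank_span_eq_card hli, Fintype.card_fin]
    omega
  let B : OrthonormalBasis (Fin d) ℂ Kᗮ := (stdOrthonormalBasis ℂ Kᗮ).reindex (finCongr hfin)
  refine ⟨fun j => (B j : E), B.orthonormal.comp_linearIsometry Kᗮ.subtypeₗᵢ, fun b => ?_⟩
  have h := one_div_gram_inv_apply_re i (i.insertNth b a : Fin (n + 1) → E)
    (by simpa using hli)
  simp only [Fin.insertNth_apply_succAbove, Fin.insertNth_apply_same] at h
  change _ = ‖Kᗮ.starProjection b‖ ^ 2 at h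
  rw [h, Submodule.starProjection_apply, Submodule.norm_coe,
    ← B.sum_sq_norm_inner_right (Kᗮ.orthogonalProjectionOnto b)]
  refine Finset.sum_congr rfl fun j _ => ?_
  rw [Submodule.inner_orthogonalProjectionOnto_eq_of_mem_left]

end Gram

/-! ### Circularly-symmetric complex Gaussian vectors -/

section Gaussian

variable {Ω : Type*} [MeasurableSpace Ω] {P : Measure Ω} {ι κ : Type*}

/-- `Z` is a zero-mean circularly-symmetric complex Gaussian vector with covariance
`E[conj (Z i) * Z j] = C i j`. -/
structure IsCircularGaussian (Z : Ω → ι → ℂ) (P : Measure Ω) (C : ι → ι → ℂ) : Prop where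
  gaussian : HasGaussianLaw Z P
  mean_zero : ∀ i, ∫ ω, Z ω i ∂P = 0
  cov : ∀ i j, ∫ ω, star (Z ω i) * Z ω j ∂P = C i j
  pseudoCov : ∀ i j, ∫ ω, Z ω i * Z ω j ∂P = 0

/-- Channel matrices as Gaussian vectors indexed by pairs (row, column). -/
theorem IsGaussianChannel.isCircularGaussian {R N : ℕ} {S : Matrix (Fin N) (Fin N) ℂ}
    {H : Ω → Matrix (Fin R) (Fin N) ℂ} (h : IsGaussianChannel P S H) :
    IsCircularGaussian (fun ω (p : Fin R × Fin N) => H ω p.1 p.2) P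
      (fun p q => if p.1 = q.1 then S p.2 q.2 else 0) where
  gaussian := h.gaussian
  mean_zero p := h.mean_zero p.1 p.2
  cov p q := h.cov p.1 q.1 p.2 q.2
  pseudoCov p q := h.pseudoCov p.1 q.1 p.2 q.2

namespace IsCircularGaussian

variable {Z : Ω → ι → ℂ} {C : ι → ι → ℂ}

theorem hasGaussianLaw_apply (h : IsCircularGaussian Z P C) (i : ι) :
    HasGaussianLaw (fun ω => Z ω i) P := HasGaussianLaw.eval (X := fun i ω => Z ω i) h.gaussian i

theorem memLp_apply (h : IsCircularGaussian Z P C) (i : ι) : MemLp (fun ω => Z ω i) 2 P :=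
  (h.hasGaussianLaw_apply i).memLp_two

theorem integrable_star_mul (h : IsCircularGaussian Z P C) (i j : ι) :
    Integrable (fun ω => star (Z ω i) * Z ω j) P :=
  (h.memLp_apply i).star.integrable_mul (h.memLp_apply j)

theorem integrable_mul (h : IsCircularGaussian Z P C) (i j : ι) :
    Integrable (fun ω => Z ω i * Z ω j) P :=
  (h.memLp_apply i).integrable_mul (h.memLp_apply j)

variable [Fintype ι] [Fintype κ]

/-- Complex-linear images of circularly-symmetric Gaussian vectors are circularly-symmetric. -/
theorem linear_image (h : IsCircularGaussian Z P C) (c : κ → ι → ℂ) :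
    IsCircularGaussian (fun ω k => ∑ i, c k i * Z ω i) P
      (fun k l => ∑ i, ∑ j, star (c k i) * c l j * C i j) where
  gaussian := by
    let T : (ι → ℂ) →L[ℝ] (κ → ℂ) := ContinuousLinearMap.pi fun k =>
      ∑ i, (ContinuousLinearMap.mul ℝ ℂ (c k i)).comp (ContinuousLinearMap.proj i)
    have hT : (fun ω k => ∑ i, c k i * Z ω i) = fun ω => T (Z ω) := by
      ext ω k
      simp [T]
    rw [hT]
    exact h.gaussian.map_fun T
  mean_zero k := by
    rw [integral_finsetSum _ fun i _ => ((h.hasGaussianLaw_apply i).integrable.const_mul _)]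
    simp [integral_const_mul, h.mean_zero]
  cov k l := by
    have : ∀ ω, star (∑ i, c k i * Z ω i) * ∑ j, c l j * Z ω j =
        ∑ i, ∑ j, star (c k i) * c l j * (star (Z ω i) * Z ω j) := by
      intro ω
      rw [star_sum, Finset.sum_mul_sum]
      refine Finset.sum_congr rfl fun i _ => Finset.sum_congr rfl fun j _ => ?_
      rw [star_mul']
      ring
    simp_rw [this]
    rw [integral_finsetSum _ fun i _ => integrable_finsetSum _ fun j _ =>
      (h.integrable_star_mul i j).const_mul _]
    refine Finset.sum_congr rfl fun i _ => ?_
    rw [integral_finsetSum _ fun j _ => (h.integrable_star_mul i j).const_mul _]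
    refine Finset.sum_congr rfl fun j _ => ?_
    rw [integral_const_mul, h.cov]
  pseudoCov k l := by
    have : ∀ ω, (∑ i, c k i * Z ω i) * ∑ j, c l j * Z ω j =
        ∑ i, ∑ j, c k i * c l j * (Z ω i * Z ω j) := by
      intro ω
      rw [Finset.sum_mul_sum]
      refine Finset.sum_congr rfl fun i _ => Finset.sum_congr rfl fun j _ => ?_
      ring
    simp_rw [this]
    rw [integral_finsetSum _ fun i _ => integrable_finsetSum _ fun j _ =>
      (h.integrable_mul i j).const_mul _]
    refine Finset.sum_eq_zero fun i _ => ?_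
    rw [integral_finsetSum _ fun j _ => (h.integrable_mul i j).const_mul _]
    refine Finset.sum_eq_zero fun j _ => ?_
    rw [integral_const_mul, h.pseudoCov, mul_zero]

end IsCircularGaussian

/-- The real part (index `0`) and imaginary part (index `1`) of a complex number. -/
noncomputable def complexPart : Fin 2 → ℂ →L[ℝ] ℝ := ![Complex.reCLM, Complex.imCLM]

/-- The standard circularly-symmetric complex Gaussian law: real and imaginary part are
independent, centered, of variance `1 / 2`. -/
noncomputable def stdComplexGaussian : Measure ℂ :=
  (Measure.pi fun _ : Fin 2 => gaussianReal 0 (1 / 2)).map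
    (fun x => (x 0 : ℂ) + (x 1 : ℂ) * Complex.I)

theorem measurable_ofReal_add_ofReal_mul_I :
    Measurable (fun x : Fin 2 → ℝ => (x 0 : ℂ) + (x 1 : ℂ) * Complex.I) := by fun_prop

instance : IsProbabilityMeasure stdComplexGaussian :=
  Measure.isProbabilityMeasure_map measurable_ofReal_add_ofReal_mul_I.aemeasurable

section Identity

variable [DecidableEq ι] {Z : Ω → ι → ℂ}

theorem IsCircularGaussian.integral_complexPart_mul
    (h : IsCircularGaussian Z P (fun i j => if i = j then 1 else 0)) (i j : ι) (s t : Fin 2) :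
    ∫ ω, complexPart s (Z ω i) * complexPart t (Z ω j) ∂P =
      if i = j ∧ s = t then 1 / 2 else 0 := by
  have h1 : ∫ ω, (star (Z ω i) * Z ω j + Z ω i * Z ω j) ∂P = if i = j then 1 else 0 := by
    rw [integral_add (h.integrable_star_mul i j) (h.integrable_mul i j), h.cov, h.pseudoCov,
      add_zero]
  have h2 : ∫ ω, (star (Z ω i) * Z ω j - Z ω i * Z ω j) ∂P = if i = j then 1 else 0 := by
    rw [integral_sub (h.integrable_star_mul i j) (h.integrable_mul i j), h.cov, h.pseudoCov,
      sub_zero]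
  have i1 := (h.integrable_star_mul i j).add (h.integrable_mul i j)
  have i2 := (h.integrable_star_mul i j).sub (h.integrable_mul i j)
  have e1 := Complex.reCLM.integral_comp_comm i1
  have e2 := Complex.reCLM.integral_comp_comm i2
  have e3 := Complex.imCLM.integral_comp_comm i1
  have e4 := Complex.imCLM.integral_comp_comm i2
  simp only [Pi.add_apply, Pi.sub_apply, h1, h2] at e1 e2 e3 e4
  have key : ∀ f : Ω → ℝ, ∀ g : Ω → ℝ, (∀ ω, f ω = g ω / 2) → ∫ ω, f ω ∂P = (∫ ω, g ω ∂P) / 2 := by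
    intro f g hfg
    simp_rw [hfg]
    exact integral_div _ _
  fin_cases s <;> fin_cases t
  · rw [key _ _ (fun ω => ?_), e1]
    · split_ifs <;> simp_all
    · simp [complexPart]
  · rw [key _ _ (fun ω => ?_), e3]
    · split_ifs <;> simp_all
    · simp [complexPart]
      ring
  · rw [key _ (fun ω => - Complex.imCLM (star (Z ω i) * Z ω j - Z ω i * Z ω j)) (fun ω => ?_),
      integral_neg, e4]
    · split_ifs <;> simp_all
    · simp [complexPart]
  · rw [key _ _ (fun ω => ?_), e2]
    · split_ifs <;> simp_all
    · simp [complexPart]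

/-- A circularly-symmetric Gaussian vector with identity covariance has independent standard
complex Gaussian coordinates. -/
theorem IsCircularGaussian.hasLaw_pi [Fintype ι]
    (h : IsCircularGaussian Z P (fun i j => if i = j then 1 else 0)) :
    HasLaw Z (Measure.pi fun _ => stdComplexGaussian) P := by
  have hP : IsProbabilityMeasure P := h.gaussian.isProbabilityMeasure
  let X : ι → Fin 2 → Ω → ℝ := fun i s ω => complexPart s (Z ω i)
  have hX : HasGaussianLaw (fun ω i s => X i s ω) P := by
    let T : (ι → ℂ) →L[ℝ] (ι → Fin 2 → ℝ) := ContinuousLinearMap.pi fun i =>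
      ContinuousLinearMap.pi fun s => (complexPart s).comp (ContinuousLinearMap.proj i)
    exact h.gaussian.map_fun T
  have hXis : ∀ i s, HasGaussianLaw (X i s) P := fun i s => (hX.eval i).eval s
  have hmean : ∀ i s, ∫ ω, X i s ω ∂P = 0 := by
    intro i s
    have := (complexPart s).integral_comp_comm (h.hasGaussianLaw_apply i).integrable
    rw [h.mean_zero, map_zero] at this
    exact this
  have hcov : ∀ i j s t, cov[X i s, X j t; P] = if i = j ∧ s = t then 1 / 2 else 0 := by
    intro i j s t
    rw [covariance_eq_sub (hXis i s).memLp_two (hXis j t).memLp_two, hmean, hmean, mul_zero,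
      sub_zero]
    exact h.integral_complexPart_mul i j s t
  have hlaw : ∀ i s, HasLaw (X i s) (gaussianReal 0 (1 / 2)) P := by
    intro i s
    refine ⟨(hXis i s).aemeasurable, ?_⟩
    rw [(hXis i s).map_eq_gaussianReal, hmean, ← covariance_self (hXis i s).aemeasurable, hcov]
    congr 1
    rw [if_pos ⟨rfl, rfl⟩]
    ext
    simp
  have hpair : ∀ i, HasLaw (fun ω s => X i s ω)
      (Measure.pi fun _ : Fin 2 => gaussianReal 0 (1 / 2)) P := by
    intro i
    refine iIndepFun.hasLaw_pi (hlaw i) ?_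
    refine HasGaussianLaw.iIndepFun_of_covariance_eq_zero (hX.eval i) fun s t hst => ?_
    rw [hcov, if_neg (by simp [hst])]
  have hind : iIndepFun (fun i ω s => X i s ω) P :=
    hX.iIndepFun_of_covariance_eval fun i j hij s t => by rw [hcov, if_neg (by simp [hij])]
  have hZ : ∀ ω i, Z ω i = ((X i 0 ω : ℝ) : ℂ) + ((X i 1 ω : ℝ) : ℂ) * Complex.I := by
    intro ω i
    simp [X, complexPart, Complex.re_add_im]
  have hlawZ : ∀ i, HasLaw (fun ω => Z ω i) stdComplexGaussian P := by
    intro i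
    have h0 : HasLaw (fun x : Fin 2 → ℝ => (x 0 : ℂ) + (x 1 : ℂ) * Complex.I) stdComplexGaussian
        (Measure.pi fun _ : Fin 2 => gaussianReal 0 (1 / 2)) :=
      ⟨measurable_ofReal_add_ofReal_mul_I.aemeasurable, rfl⟩
    have := h0.comp (hpair i)
    simp_rw [hZ]
    exact this
  refine iIndepFun.hasLaw_pi (X := fun i ω => Z ω i) hlawZ ?_
  have := hind.comp (fun _ => fun x : Fin 2 → ℝ => (x 0 : ℂ) + (x 1 : ℂ) * Complex.I)
    (fun _ => measurable_ofReal_add_ofReal_mul_I)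
  convert this using 2 with i
  ext ω
  exact hZ ω i

end Identity

end Gaussian

section StdComplex

variable {ι : Type*} [Fintype ι]

instance : IsGaussian (Measure.pi fun _ : Fin 2 => gaussianReal 0 (1 / 2)) := by
  have h := iIndepFun.hasGaussianLaw (P := Measure.pi fun _ : Fin 2 => gaussianReal 0 (1 / 2))
    (X := fun i (x : Fin 2 → ℝ) => x i) (fun i => by
      constructor
      have : Measure.map (fun x : Fin 2 → ℝ => x i)
          (Measure.pi fun _ : Fin 2 => gaussianReal 0 (1 / 2)) = gaussianReal 0 (1 / 2) :=
        (measurePreserving_eval (fun _ : Fin 2 => gaussianReal 0 (1 / 2)) i).map_eq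
      rw [this]
      infer_instance)
    (iIndepFun_pi (X := fun _ x => x) fun _ => aemeasurable_id)
  have h2 := h.isGaussian_map
  rwa [show (fun (x : Fin 2 → ℝ) i => x i) = id from rfl, Measure.map_id] at h2

instance : IsGaussian stdComplexGaussian := by
  let T : (Fin 2 → ℝ) →L[ℝ] ℂ :=
    (ContinuousLinearMap.proj (R := ℝ) (φ := fun _ : Fin 2 => ℝ) 0).smulRight (1 : ℂ) +
    (ContinuousLinearMap.proj (R := ℝ) (φ := fun _ : Fin 2 => ℝ) 1).smulRight Complex.I
  have h : stdComplexGaussian = (Measure.pi fun _ : Fin 2 => gaussianReal 0 (1 / 2)).map T := by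
    rw [stdComplexGaussian]
    congr 1
    ext x
    simp [T]
  rw [h]
  infer_instance

theorem integral_eval_mul_eval_pi_gaussianReal (s t : Fin 2) :
    ∫ x, x s * x t ∂(Measure.pi fun _ : Fin 2 => gaussianReal 0 (1 / 2)) =
      if s = t then 1 / 2 else 0 := by
  set μ := Measure.pi fun _ : Fin 2 => gaussianReal 0 (1 / 2)
  have hm : ∀ s, ∫ x, x s ∂μ = 0 := by
    intro s
    rw [integral_comp_eval (μ := fun _ : Fin 2 => gaussianReal 0 (1 / 2)) (f := fun y : ℝ => y)
      (by fun_prop), integral_id_gaussianReal]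
  split_ifs with hst
  · subst hst
    rw [integral_comp_eval (μ := fun _ : Fin 2 => gaussianReal 0 (1 / 2)) (f := fun y : ℝ => y * y)
      (by fun_prop)]
    have h := variance_fun_id_gaussianReal (μ := 0) (v := 1 / 2)
    rw [variance_eq_integral (by fun_prop), integral_id_gaussianReal] at h
    simp only [sub_zero] at h
    simp_rw [← sq, h]
    simp
  · have hi := (iIndepFun_pi (μ := fun _ : Fin 2 => gaussianReal 0 (1 / 2)) (X := fun _ x => x)
      fun _ => aemeasurable_id).indepFun hst
    rw [hi.integral_fun_mul_eq_mul_integral (measurable_pi_apply s).aestronglyMeasurable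
      (measurable_pi_apply t).aestronglyMeasurable, hm, zero_mul]

theorem integral_stdComplexGaussian_eq {E : Type*} [NormedAddCommGroup E] [NormedSpace ℝ E]
    {f : ℂ → E} (hf : AEStronglyMeasurable f stdComplexGaussian) :
    ∫ z, f z ∂stdComplexGaussian =
      ∫ x, f ((x 0 : ℂ) + (x 1 : ℂ) * Complex.I)
        ∂(Measure.pi fun _ : Fin 2 => gaussianReal 0 (1 / 2)) :=
  integral_map measurable_ofReal_add_ofReal_mul_I.aemeasurable hf

theorem integrable_eval_mul_eval_pi_gaussianReal (s t : Fin 2) :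
    Integrable (fun x : Fin 2 → ℝ => x s * x t)
      (Measure.pi fun _ : Fin 2 => gaussianReal 0 (1 / 2)) := by
  have h := IsGaussian.memLp_two_id (μ := Measure.pi fun _ : Fin 2 => gaussianReal 0 (1 / 2))
  exact (h.eval s).integrable_mul (h.eval t)

theorem integral_id_stdComplexGaussian : ∫ z, z ∂stdComplexGaussian = 0 := by
  rw [integral_stdComplexGaussian_eq (by fun_prop)]
  have h := (IsGaussian.integrable_id (μ := Measure.pi fun _ : Fin 2 => gaussianReal 0 (1 / 2)))
  have hm : ∀ s, ∫ x, ((x s : ℝ) : ℂ) ∂(Measure.pi fun _ : Fin 2 => gaussianReal 0 (1 / 2)) = 0 := by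
    intro s
    rw [integral_complex_ofReal,
      integral_comp_eval (μ := fun _ : Fin 2 => gaussianReal 0 (1 / 2)) (f := fun y : ℝ => y)
      (by fun_prop), integral_id_gaussianReal, Complex.ofReal_zero]
  rw [integral_add (h.eval 0).ofReal ((h.eval 1).ofReal.mul_const _), integral_mul_const, hm, hm]
  simp

theorem integral_normSq_stdComplexGaussian : ∫ z, ‖z‖ ^ 2 ∂stdComplexGaussian = 1 := by
  rw [integral_stdComplexGaussian_eq (by fun_prop)]
  have : ∀ x : Fin 2 → ℝ, ‖(x 0 : ℂ) + (x 1 : ℂ) * Complex.I‖ ^ 2 = x 0 * x 0 + x 1 * x 1 := by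
    intro x
    rw [← Complex.normSq_eq_norm_sq, Complex.normSq_add_mul_I]
    ring
  simp_rw [this]
  rw [integral_add (integrable_eval_mul_eval_pi_gaussianReal 0 0)
    (integrable_eval_mul_eval_pi_gaussianReal 1 1), integral_eval_mul_eval_pi_gaussianReal,
    integral_eval_mul_eval_pi_gaussianReal]
  norm_num

theorem integral_mul_self_stdComplexGaussian : ∫ z, z * z ∂stdComplexGaussian = 0 := by
  rw [integral_stdComplexGaussian_eq (by fun_prop)]
  have : ∀ x : Fin 2 → ℝ, ((x 0 : ℂ) + (x 1 : ℂ) * Complex.I) * ((x 0 : ℂ) + (x 1 : ℂ) * Complex.I)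
      = (((x 0 * x 0 - x 1 * x 1 : ℝ) : ℂ)) + ((x 0 * x 1 : ℝ) : ℂ) * (2 * Complex.I) := by
    intro x
    push_cast
    linear_combination (x 1 : ℂ) * (x 1 : ℂ) * Complex.I_mul_I
  simp_rw [this]
  have i1 := (integrable_eval_mul_eval_pi_gaussianReal 0 0).sub
    (integrable_eval_mul_eval_pi_gaussianReal 1 1)
  rw [integral_add i1.ofReal
    ((integrable_eval_mul_eval_pi_gaussianReal 0 1).ofReal.mul_const _), integral_mul_const,
    integral_complex_ofReal, integral_complex_ofReal,
    integral_sub (integrable_eval_mul_eval_pi_gaussianReal 0 0)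
    (integrable_eval_mul_eval_pi_gaussianReal 1 1), integral_eval_mul_eval_pi_gaussianReal,
    integral_eval_mul_eval_pi_gaussianReal, integral_eval_mul_eval_pi_gaussianReal]
  simp

theorem isCircularGaussian_pi_stdComplexGaussian [DecidableEq ι] :
    IsCircularGaussian (fun x : ι → ℂ => x) (Measure.pi fun _ => stdComplexGaussian)
      (fun i j => if i = j then 1 else 0) := by
  have hind := iIndepFun_pi (μ := fun _ : ι => stdComplexGaussian) (X := fun _ x => x)
      fun _ => aemeasurable_id
  have hmean : ∀ i, ∫ x : ι → ℂ, x i ∂(Measure.pi fun _ => stdComplexGaussian) = 0 := by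
    intro i
    rw [integral_comp_eval (μ := fun _ : ι => stdComplexGaussian) (f := fun y : ℂ => y)
      (by fun_prop), integral_id_stdComplexGaussian]
  refine ⟨iIndepFun.hasGaussianLaw (X := fun i (x : ι → ℂ) => x i) (fun i => ⟨?_⟩) hind, hmean,
    fun i j => ?_, fun i j => ?_⟩
  · have : Measure.map (fun x : ι → ℂ => x i) (Measure.pi fun _ => stdComplexGaussian) =
        stdComplexGaussian := (measurePreserving_eval (fun _ : ι => stdComplexGaussian) i).map_eq
    rw [this]
    infer_instance
  · split_ifs with hij
    · subst hij
      rw [integral_comp_eval (μ := fun _ : ι => stdComplexGaussian) (f := fun y : ℂ => star y * y)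
        (by fun_prop)]
      have : ∀ z : ℂ, star z * z = ((‖z‖ ^ 2 : ℝ) : ℂ) := by
        intro z
        rw [← Complex.normSq_eq_norm_sq, Complex.normSq_eq_conj_mul_self]
        rfl
      simp_rw [this]
      rw [integral_complex_ofReal, integral_normSq_stdComplexGaussian, Complex.ofReal_one]
    · have h2 := (hind.indepFun hij).comp (φ := fun z : ℂ => star z) (ψ := fun z : ℂ => z)
        (by fun_prop) measurable_id
      have h3 := h2.integral_fun_mul_eq_mul_integral
        (continuous_star.measurable.comp (measurable_pi_apply i)).aestronglyMeasurable
        (measurable_pi_apply j).aestronglyMeasurable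
      refine h3.trans ?_
      simp only [Function.comp_apply, hmean, mul_zero]
  · by_cases hij : i = j
    · subst hij
      rw [integral_comp_eval (μ := fun _ : ι => stdComplexGaussian) (f := fun y : ℂ => y * y)
        (by fun_prop), integral_mul_self_stdComplexGaussian]
    · rw [(hind.indepFun hij).integral_fun_mul_eq_mul_integral
        (measurable_pi_apply i).aestronglyMeasurable (measurable_pi_apply j).aestronglyMeasurable,
        hmean, zero_mul]

/-- Unitary invariance: the coordinates of a standard Gaussian vector along an orthonormal family
are again independent and standard. -/
theorem hasLaw_inner_of_orthonormal {R d : ℕ} {e : Fin d → EuclideanSpace ℂ (Fin R)}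
    (he : Orthonormal ℂ e) :
    HasLaw (fun (b : Fin R → ℂ) j => inner ℂ (e j) (WithLp.toLp 2 b))
      (Measure.pi fun _ : Fin d => stdComplexGaussian)
      (Measure.pi fun _ : Fin R => stdComplexGaussian) := by
  have h := (isCircularGaussian_pi_stdComplexGaussian (ι := Fin R)).linear_image
    (fun (j : Fin d) r => star (e j r))
  have hc : (fun k l : Fin d => ∑ i : Fin R, ∑ j : Fin R,
      star (star (e k i)) * star (e l j) * (if i = j then (1 : ℂ) else 0)) =
      fun k l => if k = l then 1 else 0 := by
    ext k l
    have h1 := orthonormal_iff_ite.1 he l k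
    rw [EuclideanSpace.inner_eq_star_dotProduct] at h1
    simp only [eq_comm (a := l)] at h1
    rw [← h1]
    simp [dotProduct]
  rw [hc] at h
  convert h.hasLaw_pi using 3 with b j
  rw [EuclideanSpace.inner_eq_star_dotProduct]
  simp [dotProduct, mul_comm]

end StdComplex

/-! ### Diagonal entries of the inverse of a complex Wishart matrix -/

section Wishart

/-- The law of `∑ j < d, |x j|²` for independent standard complex Gaussian `x j` (a Gamma law with
shape `d` and unit scale). -/
noncomputable def complexChiSq (d : ℕ) : Measure ℝ :=
  (Measure.pi fun _ : Fin d => stdComplexGaussian).map (fun x => ∑ j, ‖x j‖ ^ 2)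

/-- The inverse of the `i`-th diagonal entry of the inverse Gram matrix of the vectors `a j`. -/
noncomputable def invGramDiag {R N : ℕ} (i : Fin N) (a : Fin N → Fin R → ℂ) : ℝ :=
  1 / ((Matrix.gram ℂ (fun j => WithLp.toLp 2 (a j)))⁻¹ i i).re

theorem measurable_invGramDiag {R N : ℕ} (i : Fin N) :
    Measurable (invGramDiag i : (Fin N → Fin R → ℂ) → ℝ) := by
  have hG : Continuous fun a : Fin N → Fin R → ℂ =>
      Matrix.gram ℂ (fun j => WithLp.toLp 2 (a j)) := by
    refine continuous_matrix fun k l => ?_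
    simp only [Matrix.gram_apply]
    fun_prop
  unfold invGramDiag
  simp_rw [Matrix.inv_def, Ring.inverse_eq_inv', Matrix.smul_apply, smul_eq_mul]
  have h1 := hG.matrix_det.measurable
  have h2 := (hG.matrix_adjugate.matrix_elem i i).measurable
  exact measurable_const.div (Complex.measurable_re.comp (h1.inv.mul h2))

theorem stdComplexGaussian_singleton_zero : stdComplexGaussian {0} = 0 := by
  rw [stdComplexGaussian, Measure.map_apply measurable_ofReal_add_ofReal_mul_I
    (measurableSet_singleton 0)]
  refine measure_mono_null (t := Function.eval 0 ⁻¹' {0}) (fun x hx => ?_) ?_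
  · have := congrArg Complex.re (show (x 0 : ℂ) + (x 1 : ℂ) * Complex.I = 0 from hx)
    simpa using this
  · rw [(measurePreserving_eval (fun _ : Fin 2 => gaussianReal 0 (1 / 2)) 0).measure_preimage
      (measurableSet_singleton 0).nullMeasurableSet]
    have : NullSingletonClass (gaussianReal 0 (1 / 2)) :=
      nullSingletonClass_gaussianReal (by norm_num)
    exact measure_singleton 0

/-- Fewer than `R` independent vectors in `ℂ^R` remain independent, almost surely, when a
Gaussian vector is added. -/
theorem ae_linearIndependent_cons {R n : ℕ} (hn : n < R) {a : Fin n → Fin R → ℂ}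
    (ha : LinearIndependent ℂ a) :
    ∀ᵐ b ∂(Measure.pi fun _ : Fin R => stdComplexGaussian),
      LinearIndependent ℂ (Fin.cons b a : Fin (n + 1) → Fin R → ℂ) := by
  let T := (WithLp.linearEquiv 2 ℂ (Fin R → ℂ)).symm
  have ha' : LinearIndependent ℂ (T ∘ a) := ha.map' T.toLinearMap (LinearEquiv.ker T)
  obtain ⟨e, he, hsum⟩ := exists_orthonormal_one_div_gram_inv (d := R - n) (by simp; omega)
    (0 : Fin (n + 1)) (T ∘ a) ha'
  have hlaw := hasLaw_inner_of_orthonormal he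
  let j0 : Fin (R - n) := ⟨0, by omega⟩
  have h0 : ∀ᵐ x ∂(Measure.pi fun _ : Fin (R - n) => stdComplexGaussian), x j0 ≠ 0 := by
    have := (measurePreserving_eval (fun _ : Fin (R - n) => stdComplexGaussian)
      j0).quasiMeasurePreserving.ae (p := fun z => z ≠ 0)
      (by rw [ae_iff]; simpa using stdComplexGaussian_singleton_zero)
    exact this
  have h1 : ∀ᵐ b ∂(Measure.pi fun _ : Fin R => stdComplexGaussian),
      inner ℂ (e j0) (WithLp.toLp 2 b) ≠ 0 := by
    rw [← hlaw.map_eq] at h0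
    exact ae_of_ae_map hlaw.aemeasurable h0
  filter_upwards [h1] with b hb
  by_contra hcon
  have hcon' : ¬ LinearIndependent ℂ (Fin.insertNth 0 (T b) (T ∘ a) :
      Fin (n + 1) → EuclideanSpace ℂ (Fin R)) := by
    intro h
    apply hcon
    have h2 : (Fin.cons b a : Fin (n + 1) → Fin R → ℂ) =
        T.symm.toLinearMap ∘ Fin.insertNth 0 (T b) (T ∘ a) := by
      ext k r
      refine Fin.cases ?_ (fun k => ?_) k <;> simp
    rw [h2]
    exact h.map' T.symm.toLinearMap (LinearEquiv.ker T.symm)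
  have h3 := hsum (T b)
  rw [Matrix.nonsing_inv_apply_not_isUnit _
    (by rwa [isUnit_iff_ne_zero, Matrix.det_gram_ne_zero_iff_linearIndependent])] at h3
  have h4 : ∑ j, ‖inner ℂ (e j) (T b)‖ ^ 2 = 0 := by rw [← h3]; simp
  rw [Finset.sum_eq_zero_iff_of_nonneg fun _ _ => by positivity] at h4
  exact hb (norm_eq_zero.1 ((pow_eq_zero_iff two_ne_zero).1 (h4 j0 (Finset.mem_univ _))))

theorem ae_linearIndependent_pi {R : ℕ} : ∀ n : ℕ, n ≤ R →
    ∀ᵐ a ∂(Measure.pi fun _ : Fin n => Measure.pi fun _ : Fin R => stdComplexGaussian),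
      LinearIndependent ℂ a
  | 0, _ => Eventually.of_forall fun _ => linearIndependent_empty_type
  | n + 1, hn => by
    have hmp := measurePreserving_piFinSuccAbove
      (fun _ : Fin (n + 1) => Measure.pi fun _ : Fin R => stdComplexGaussian) 0
    have hmeas : MeasurableSet {z : (Fin R → ℂ) × (Fin n → Fin R → ℂ) |
        LinearIndependent ℂ (Fin.cons z.1 z.2 : Fin (n + 1) → Fin R → ℂ)} := by
      refine (IsOpen.preimage (f := fun z : (Fin R → ℂ) × (Fin n → Fin R → ℂ) =>
        (Fin.cons z.1 z.2 : Fin (n + 1) → Fin R → ℂ)) ?_ isOpen_setOfPred_linearIndependent).measurableSet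
      fun_prop
    have h : ∀ᵐ z ∂((Measure.pi fun _ : Fin R => stdComplexGaussian).prod
        (Measure.pi fun _ : Fin n => Measure.pi fun _ : Fin R => stdComplexGaussian)),
        LinearIndependent ℂ (Fin.cons z.1 z.2 : Fin (n + 1) → Fin R → ℂ) := by
      rw [Measure.ae_prod_iff_ae_ae hmeas, Measure.ae_ae_comm hmeas]
      filter_upwards [ae_linearIndependent_pi n (by omega)] with a ha
      exact ae_linearIndependent_cons (by omega) ha
    have h2 := hmp.quasiMeasurePreserving.ae h
    filter_upwards [h2] with a ha
    convert ha using 1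
    ext k r
    refine Fin.cases ?_ (fun k => ?_) k <;> simp [MeasurableEquiv.piFinSuccAbove, Fin.tail]

theorem hasLaw_invGramDiag {R n d : ℕ} (hd : n + d = R) (i : Fin (n + 1)) :
    HasLaw (invGramDiag i : (Fin (n + 1) → Fin R → ℂ) → ℝ) (complexChiSq d)
      (Measure.pi fun _ => Measure.pi fun _ => stdComplexGaussian) := by
  set ν := Measure.pi fun _ : Fin R => stdComplexGaussian with hν
  refine ⟨(measurable_invGramDiag i).aemeasurable, ?_⟩
  have hmp := (measurePreserving_piFinSuccAbove (fun _ : Fin (n + 1) => ν) i).symm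
  rw [← hmp.map_eq, Measure.map_map (measurable_invGramDiag i) hmp.measurable]
  have hmeas := (measurable_invGramDiag (R := R) i).comp hmp.measurable
  ext s hs
  rw [Measure.map_apply hmeas hs, Measure.prod_apply_symm (hmeas hs)]
  have hcond : ∀ᵐ a ∂(Measure.pi fun _ : Fin n => ν),
      ν ((fun b => (b, a)) ⁻¹' ((invGramDiag i ∘
        (MeasurableEquiv.piFinSuccAbove (fun _ => Fin R → ℂ) i).symm) ⁻¹' s)) =
        complexChiSq d s := by
    filter_upwards [ae_linearIndependent_pi (R := R) n (by omega)] with a ha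
    let T := (WithLp.linearEquiv 2 ℂ (Fin R → ℂ)).symm
    obtain ⟨e, he, hsum⟩ := exists_orthonormal_one_div_gram_inv (d := d) (by simp; omega)
      i (T ∘ a) (ha.map' T.toLinearMap (LinearEquiv.ker T))
    have hq : Measurable fun x : Fin d → ℂ => ∑ j, ‖x j‖ ^ 2 := by fun_prop
    have hlaw : HasLaw (fun b : Fin R → ℂ => ∑ j, ‖inner ℂ (e j) (WithLp.toLp 2 b)‖ ^ 2)
        (complexChiSq d) ν :=
      HasLaw.comp (Y := fun x : Fin d → ℂ => ∑ j, ‖x j‖ ^ 2) ⟨hq.aemeasurable, rfl⟩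
        (hasLaw_inner_of_orthonormal he)
    rw [← hlaw.map_eq, Measure.map_apply (by fun_prop) hs]
    congr 1
    ext b
    have h1 : invGramDiag i ((MeasurableEquiv.piFinSuccAbove (fun _ => Fin R → ℂ) i).symm (b, a)) =
        ∑ j, ‖inner ℂ (e j) (WithLp.toLp 2 b)‖ ^ 2 := by
      refine Eq.trans ?_ (hsum (T b))
      have hv : (fun k => WithLp.toLp 2
          ((MeasurableEquiv.piFinSuccAbove (fun _ => Fin R → ℂ) i).symm (b, a) k)) =
          (i.insertNth (T b) (T ∘ a) : Fin (n + 1) → EuclideanSpace ℂ (Fin R)) := by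
        rw [show (MeasurableEquiv.piFinSuccAbove (fun _ => Fin R → ℂ) i).symm (b, a) =
          i.insertNth b a from rfl]
        ext k r
        induction k using i.succAboveCases <;> simp [T]
      rw [invGramDiag, hv]
    simp only [Set.mem_preimage, Function.comp_apply, h1]
  rw [lintegral_congr_ae hcond]
  simp

end Wishart

/-! ### Moments of sums of independent centered variables -/

section Moments

variable {Ω ι : Type*} [MeasurableSpace Ω] {μ : Measure Ω} [IsProbabilityMeasure μ]

theorem MeasureTheory.MemLp.integrable_pow_of_le {X : Ω → ℝ} {p : ℕ} (h : MemLp X p μ) {k : ℕ}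
    (hk : k ≤ p) : Integrable (fun ω => X ω ^ k) μ := by
  have h1 : MemLp X k μ := h.mono_exponent (by exact_mod_cast hk)
  rw [← integrable_norm_iff (f := fun ω => X ω ^ k) (h1.aestronglyMeasurable.pow k)]
  simp_rw [norm_pow]
  exact h1.integrable_norm_pow'

/-- Second and fourth moments of a sum of independent centered variables: in the fourth moment
only the terms with even exponents survive. -/
theorem ProbabilityTheory.iIndepFun.integral_sum_pow_le {X : ι → Ω → ℝ} (hind : iIndepFun X μ)
    (hX : ∀ i, MemLp (X i) 4 μ) (hmean : ∀ i, ∫ ω, X i ω ∂μ = 0) {v κ : ℝ}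
    (h2 : ∀ i, ∫ ω, X i ω ^ 2 ∂μ = v) (h4 : ∀ i, ∫ ω, X i ω ^ 4 ∂μ ≤ κ) (s : Finset ι) :
    ∫ ω, (∑ i ∈ s, X i ω) ∂μ = 0 ∧ ∫ ω, (∑ i ∈ s, X i ω) ^ 2 ∂μ = v * s.card ∧
      ∫ ω, (∑ i ∈ s, X i ω) ^ 4 ∂μ ≤ 3 * v ^ 2 * (s.card : ℝ) ^ 2 + κ * s.card := by
  classical
  induction s using Finset.induction_on with
  | empty => simp
  | insert a s ha ih =>
    obtain ⟨ih1, ih2, ih4⟩ := ih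
    set S : Ω → ℝ := fun ω => ∑ i ∈ s, X i ω with hS
    have hSL : MemLp S 4 μ := memLp_finsetSum s fun i _ => hX i
    have hi : IndepFun S (X a) μ := by
      have := hind.indepFun_finsetSum_of_notMem₀ (fun i => (hX i).aestronglyMeasurable.aemeasurable)
        ha
      convert this using 1
      ext ω
      simp [hS]
    have iS : ∀ k ≤ 4, Integrable (fun ω => S ω ^ k) μ := fun k hk =>
      MemLp.integrable_pow_of_le (p := 4) (by exact_mod_cast hSL) hk
    have iX : ∀ k ≤ 4, Integrable (fun ω => X a ω ^ k) μ := fun k hk =>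
      MemLp.integrable_pow_of_le (p := 4) (by exact_mod_cast hX a) hk
    have hik : ∀ k l, IndepFun (fun ω => S ω ^ k) (fun ω => X a ω ^ l) μ := fun k l =>
      hi.comp (φ := fun x => x ^ k) (ψ := fun x => x ^ l) (by fun_prop) (by fun_prop)
    have iSX : ∀ k ≤ 4, ∀ l ≤ 4, Integrable (fun ω => S ω ^ k * X a ω ^ l) μ := fun k hk l hl =>
      (hik k l).integrable_mul (iS k hk) (iX l hl)
    have eSX : ∀ k ≤ 4, ∀ l ≤ 4, ∫ ω, S ω ^ k * X a ω ^ l ∂μ =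
        (∫ ω, S ω ^ k ∂μ) * ∫ ω, X a ω ^ l ∂μ := fun k hk l hl =>
      (hik k l).integral_fun_mul_eq_mul_integral (iS k hk).aestronglyMeasurable
        (iX l hl).aestronglyMeasurable
    have iS1 : ∫ ω, S ω ^ 1 ∂μ = 0 := by simpa using ih1
    have iX1 : ∫ ω, X a ω ^ 1 ∂μ = 0 := by simpa using hmean a
    have hsum : ∀ ω, ∑ i ∈ insert a s, X i ω = S ω + X a ω := fun ω => by
      rw [Finset.sum_insert ha, add_comm]
    simp_rw [hsum]
    have hcard : ((insert a s).card : ℝ) = s.card + 1 := by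
      rw [Finset.card_insert_of_notMem ha]
      push_cast
      ring
    rw [hcard]
    refine ⟨?_, ?_, ?_⟩
    · rw [integral_add (by simpa using iS 1 (by norm_num)) (by simpa using iX 1 (by norm_num)),
        hmean, ih1, add_zero]
    · have : ∀ ω, (S ω + X a ω) ^ 2 = S ω ^ 2 + (2 * (S ω ^ 1 * X a ω ^ 1) + X a ω ^ 2) := fun ω => by
        ring
      simp_rw [this]
      have j1 := (iSX 1 (by norm_num) 1 (by norm_num)).const_mul 2
      have j2 := iX 2 (by norm_num)
      rw [integral_add (iS 2 (by norm_num)) (j1.fun_add j2), integral_add j1 j2, integral_const_mul,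
        eSX 1 (by norm_num) 1 (by norm_num), iX1, h2, ih2]
      ring
    · have : ∀ ω, (S ω + X a ω) ^ 4 = S ω ^ 4 + (4 * (S ω ^ 3 * X a ω ^ 1) +
          (6 * (S ω ^ 2 * X a ω ^ 2) + (4 * (S ω ^ 1 * X a ω ^ 3) + X a ω ^ 4))) := fun ω => by
        ring
      simp_rw [this]
      have j1 := (iSX 3 (by norm_num) 1 (by norm_num)).const_mul 4
      have j2 := (iSX 2 (by norm_num) 2 (by norm_num)).const_mul 6
      have j3 := (iSX 1 (by norm_num) 3 (by norm_num)).const_mul 4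
      have j4 := iX 4 (by norm_num)
      rw [integral_add (iS 4 (by norm_num)) (j1.fun_add (j2.fun_add (j3.fun_add j4))),
        integral_add j1 (j2.fun_add (j3.fun_add j4)), integral_add j2 (j3.fun_add j4), integral_add j3 j4,
        integral_const_mul, integral_const_mul, integral_const_mul,
        eSX 3 (by norm_num) 1 (by norm_num), eSX 2 (by norm_num) 2 (by norm_num),
        eSX 1 (by norm_num) 3 (by norm_num), iX1, iS1, h2, ih2]
      nlinarith [h4 a, sq_nonneg v]

/-- The mean of the Gamma law `complexChiSq d`, and the order of magnitude of its second and fourth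
central moments. -/
theorem exists_moments_complexChiSq : ∃ C : ℝ, 0 ≤ C ∧ ∀ d : ℕ,
    MemLp id 4 (complexChiSq d) ∧ ∫ x, x ∂complexChiSq d = d ∧
      ∫ x, (x - d) ^ 2 ∂complexChiSq d ≤ C * d ∧
      ∫ x, (x - d) ^ 4 ∂complexChiSq d ≤ C * (d : ℝ) ^ 2 := by
  set X : ℂ → ℝ := fun z => ‖z‖ ^ 2 - 1 with hXdef
  have hXmeas : Measurable X := by fun_prop
  have hsq : MemLp (fun z : ℂ => ‖z‖ ^ 2) 4 stdComplexGaussian := by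
    have h8 := (IsGaussian.memLp_id stdComplexGaussian 8 (by norm_num)).norm_rpow_div 2
    have e : (8 : ENNReal) / 2 = 4 :=
      ((ENNReal.eq_div_iff (by norm_num) (by norm_num)).2 (by norm_num)).symm
    rw [e] at h8
    simpa using h8
  have hXL : MemLp X 4 stdComplexGaussian := hsq.sub (memLp_const 1)
  have hX0 : ∫ z, X z ∂stdComplexGaussian = 0 := by
    rw [integral_sub (hsq.integrable (by norm_num)) (integrable_const 1),
      integral_normSq_stdComplexGaussian]
    simp
  set v := ∫ z, X z ^ 2 ∂stdComplexGaussian with hv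
  set κ := ∫ z, X z ^ 4 ∂stdComplexGaussian with hκ
  have hv0 : 0 ≤ v := integral_nonneg fun _ => by positivity
  have hκ0 : 0 ≤ κ := integral_nonneg fun _ => by positivity
  refine ⟨v + (3 * v ^ 2 + κ), by positivity, fun d => ?_⟩
  set π := Measure.pi fun _ : Fin d => stdComplexGaussian with hπ
  have hind : iIndepFun (fun (j : Fin d) (x : Fin d → ℂ) => X (x j)) π :=
    iIndepFun_pi (X := fun _ => X) fun _ => hXmeas.aemeasurable
  have heval : ∀ j : Fin d, MeasurePreserving (fun x : Fin d → ℂ => x j) π stdComplexGaussian :=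
    fun j => measurePreserving_eval (fun _ : Fin d => stdComplexGaussian) j
  have hL : ∀ j : Fin d, MemLp (fun x : Fin d → ℂ => X (x j)) 4 π := fun j =>
    hXL.comp_measurePreserving (heval j)
  have hint : ∀ (j : Fin d) (f : ℂ → ℝ), Measurable f →
      ∫ x : Fin d → ℂ, f (x j) ∂π = ∫ z, f z ∂stdComplexGaussian := fun j f hf =>
    integral_comp_eval (μ := fun _ : Fin d => stdComplexGaussian) hf.aestronglyMeasurable
  obtain ⟨m1, m2, m4⟩ := hind.integral_sum_pow_le hL
    (fun j => by rw [hint j X hXmeas, hX0])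
    (v := v) (κ := κ) (fun j => hint j (fun z => X z ^ 2) (by fun_prop))
    (fun j => (hint j (fun z => X z ^ 4) (by fun_prop)).le) Finset.univ
  have hq : Measurable fun x : Fin d → ℂ => ∑ j, ‖x j‖ ^ 2 := by fun_prop
  have hsub : ∀ x : Fin d → ℂ, ∑ j, ‖x j‖ ^ 2 - (d : ℝ) = ∑ j, X (x j) := fun x => by
    simp [hXdef, Finset.sum_sub_distrib]
  have hsumL : MemLp (fun x : Fin d → ℂ => ∑ j, ‖x j‖ ^ 2) 4 π :=
    memLp_finsetSum _ fun j _ => hsq.comp_measurePreserving (heval j)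
  simp only [Finset.card_univ, Fintype.card_fin] at m2 m4
  have hd : (d : ℝ) ≤ (d : ℝ) ^ 2 := by
    rcases Nat.eq_zero_or_pos d with h | h
    · simp [h]
    · have : (1 : ℝ) ≤ d := by exact_mod_cast h
      nlinarith
  have hd0 : (0 : ℝ) ≤ d := by positivity
  refine ⟨?_, ?_, ?_, ?_⟩
  · rw [complexChiSq, memLp_map_measure_iff (by fun_prop) hq.aemeasurable]
    exact hsumL
  · rw [complexChiSq, integral_map hq.aemeasurable (by fun_prop)]
    have : ∀ x : Fin d → ℂ, ∑ j, ‖x j‖ ^ 2 = ∑ j, X (x j) + (d : ℝ) := fun x => by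
      rw [← hsub]; ring
    simp_rw [this]
    rw [integral_add ((memLp_finsetSum _ fun j _ => hL j).integrable (by norm_num))
      (integrable_const _), m1]
    simp
  · rw [complexChiSq, integral_map hq.aemeasurable (by fun_prop)]
    simp_rw [hsub]
    rw [m2]
    nlinarith [sq_nonneg v, mul_nonneg (add_nonneg (mul_nonneg zero_le_three (sq_nonneg v)) hκ0) hd0]
  · rw [complexChiSq, integral_map hq.aemeasurable (by fun_prop)]
    simp_rw [hsub]
    refine m4.trans ?_
    nlinarith [mul_nonneg hv0 (sq_nonneg (d : ℝ)), mul_le_mul_of_nonneg_left hd hκ0]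

end Moments

/-! ### Comparison of spectra -/

section Spectra

variable {N : ℕ}

theorem sum_sum_norm_sq_eq_trace (A : Matrix (Fin N) (Fin N) ℂ) :
    ((∑ i, ∑ j, ‖A i j‖ ^ 2 : ℝ) : ℂ) = (A.conjTranspose * A).trace := by
  rw [Matrix.trace, Finset.sum_comm]
  push_cast
  refine Finset.sum_congr rfl fun j _ => ?_
  rw [Matrix.diag_apply, Matrix.mul_apply]
  refine Finset.sum_congr rfl fun i _ => ?_
  rw [Matrix.conjTranspose_apply, ← Complex.ofReal_pow, ← Complex.normSq_eq_norm_sq,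
    Complex.normSq_eq_conj_mul_self]
  rfl

theorem sum_sum_norm_sq_star_mul {W : Matrix (Fin N) (Fin N) ℂ}
    (hW : W ∈ Matrix.unitaryGroup (Fin N) ℂ) (A : Matrix (Fin N) (Fin N) ℂ) :
    ∑ i, ∑ j, ‖(W.conjTranspose * A) i j‖ ^ 2 = ∑ i, ∑ j, ‖A i j‖ ^ 2 := by
  have h : W * W.conjTranspose = 1 := Matrix.mem_unitaryGroup_iff.1 hW
  apply Complex.ofReal_injective
  rw [sum_sum_norm_sq_eq_trace, sum_sum_norm_sq_eq_trace, Matrix.conjTranspose_mul,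
    Matrix.conjTranspose_conjTranspose, Matrix.mul_assoc, ← Matrix.mul_assoc W, h, Matrix.one_mul]

theorem sum_norm_sq_row_of_mem_unitaryGroup {Q : Matrix (Fin N) (Fin N) ℂ}
    (hQ : Q ∈ Matrix.unitaryGroup (Fin N) ℂ) (i : Fin N) : ∑ j, ‖Q i j‖ ^ 2 = 1 := by
  have h := congrFun (congrFun (Matrix.mem_unitaryGroup_iff.1 hQ) i) i
  rw [Matrix.mul_apply, Matrix.one_apply_eq] at h
  apply Complex.ofReal_injective
  rw [Complex.ofReal_one, ← h]
  push_cast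
  refine Finset.sum_congr rfl fun j _ => ?_
  rw [← Complex.ofReal_pow, ← Complex.normSq_eq_norm_sq, ← Complex.mul_conj]
  rfl

theorem sum_norm_sq_col_of_mem_unitaryGroup {Q : Matrix (Fin N) (Fin N) ℂ}
    (hQ : Q ∈ Matrix.unitaryGroup (Fin N) ℂ) (j : Fin N) : ∑ i, ‖Q i j‖ ^ 2 = 1 := by
  have h := sum_norm_sq_row_of_mem_unitaryGroup (Unitary.star_mem hQ) j
  simpa using h

/-- If the columns of a unitary matrix `U` are approximate eigenvectors of `T` for the approximate
eigenvalues `b j`, the sums of a Lipschitz function over the spectrum of `T` and over the real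
parts of the `b j` are close. The weights `|(Wᴴ U) i j|²` are doubly stochastic, and
`∑ |(Wᴴ U) i j|² |lam i - b j|²` is the squared Frobenius norm of `T U - U diag b`. -/
theorem IsEigenDecomp.abs_sum_sub_sum_le {T W : Matrix (Fin N) (Fin N) ℂ} {lam : Fin N → ℝ}
    (hW : IsEigenDecomp T W lam) {U : Matrix (Fin N) (Fin N) ℂ}
    (hU : U ∈ Matrix.unitaryGroup (Fin N) ℂ) (b : Fin N → ℂ) {f : ℝ → ℝ} {K : ℝ} (hK : 0 ≤ K)
    (hf : ∀ x y, |f x - f y| ≤ K * |x - y|) :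
    |∑ i, f (lam i) - ∑ j, f (b j).re| ≤
      K * Real.sqrt (N * ∑ i, ∑ j, ‖(T * U - U * Matrix.diagonal b) i j‖ ^ 2) := by
  set Q := W.conjTranspose * U with hQ
  have hQu : Q ∈ Matrix.unitaryGroup (Fin N) ℂ :=
    mul_mem (Unitary.star_mem hW.unitary) hU
  have hWW : W.conjTranspose * W = 1 := Matrix.mem_unitaryGroup_iff'.1 hW.unitary
  have hentry : ∀ i j, (W.conjTranspose * (T * U - U * Matrix.diagonal b)) i j =
      ((lam i : ℂ) - b j) * Q i j := by
    intro i j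
    have : W.conjTranspose * (T * U - U * Matrix.diagonal b) =
        Matrix.diagonal (fun i => (lam i : ℂ)) * Q - Q * Matrix.diagonal b := by
      rw [Matrix.mul_sub, hW.eq, hQ, ← Matrix.mul_assoc, ← Matrix.mul_assoc, ← Matrix.mul_assoc,
        ← Matrix.mul_assoc, hWW, Matrix.one_mul, Matrix.mul_assoc _ W.conjTranspose U]
    rw [this, Matrix.sub_apply, Matrix.diagonal_mul, Matrix.mul_diagonal]
    ring
  have hfrob : ∑ i, ∑ j, ‖Q i j‖ ^ 2 * ‖(lam i : ℂ) - b j‖ ^ 2 =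
      ∑ i, ∑ j, ‖(T * U - U * Matrix.diagonal b) i j‖ ^ 2 := by
    rw [← sum_sum_norm_sq_star_mul hW.unitary]
    refine Finset.sum_congr rfl fun i _ => Finset.sum_congr rfl fun j _ => ?_
    rw [hentry, norm_mul, mul_pow, mul_comm]
  have hdiff : ∑ i, f (lam i) - ∑ j, f (b j).re =
      ∑ i, ∑ j, ‖Q i j‖ ^ 2 * (f (lam i) - f (b j).re) := by
    simp_rw [mul_sub, Finset.sum_sub_distrib]
    congr 1
    · refine Finset.sum_congr rfl fun i _ => ?_
      rw [← Finset.sum_mul, sum_norm_sq_row_of_mem_unitaryGroup hQu, one_mul]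
    · rw [Finset.sum_comm]
      refine Finset.sum_congr rfl fun j _ => ?_
      rw [← Finset.sum_mul, sum_norm_sq_col_of_mem_unitaryGroup hQu, one_mul]
  have hone : ∑ i, ∑ j, ‖Q i j‖ ^ 2 = (N : ℝ) := by
    simp_rw [sum_norm_sq_row_of_mem_unitaryGroup hQu]
    simp
  have hterm : ∀ i j, |‖Q i j‖ ^ 2 * (f (lam i) - f (b j).re)| ≤
      K * (‖Q i j‖ * (‖Q i j‖ * ‖(lam i : ℂ) - b j‖)) := by
    intro i j
    have h1 : |lam i - (b j).re| ≤ ‖(lam i : ℂ) - b j‖ := by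
      simpa using Complex.abs_re_le_norm ((lam i : ℂ) - b j)
    rw [abs_mul, abs_of_nonneg (by positivity)]
    calc ‖Q i j‖ ^ 2 * |f (lam i) - f (b j).re| ≤ ‖Q i j‖ ^ 2 * (K * ‖(lam i : ℂ) - b j‖) := by
          gcongr
          exact (hf _ _).trans (by gcongr)
      _ = _ := by ring
  have hcs : ∑ p : Fin N × Fin N, ‖Q p.1 p.2‖ * (‖Q p.1 p.2‖ * ‖(lam p.1 : ℂ) - b p.2‖) ≤
      Real.sqrt (∑ p : Fin N × Fin N, ‖Q p.1 p.2‖ ^ 2) *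
        Real.sqrt (∑ p : Fin N × Fin N, (‖Q p.1 p.2‖ * ‖(lam p.1 : ℂ) - b p.2‖) ^ 2) :=
    Real.sum_mul_le_sqrt_mul_sqrt _ _ _
  simp_rw [Fintype.sum_prod_type, mul_pow] at hcs
  rw [hone, hfrob, ← Real.sqrt_mul (by positivity)] at hcs
  rw [hdiff]
  calc |∑ i, ∑ j, ‖Q i j‖ ^ 2 * (f (lam i) - f (b j).re)|
      ≤ ∑ i, ∑ j, K * (‖Q i j‖ * (‖Q i j‖ * ‖(lam i : ℂ) - b j‖)) := by
        refine (Finset.abs_sum_le_sum_abs _ _).trans (Finset.sum_le_sum fun i _ => ?_)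
        exact (Finset.abs_sum_le_sum_abs _ _).trans (Finset.sum_le_sum fun j _ => hterm i j)
    _ = K * ∑ i, ∑ j, (‖Q i j‖ * (‖Q i j‖ * ‖(lam i : ℂ) - b j‖)) := by
        simp_rw [Finset.mul_sum]
    _ ≤ _ := by gcongr

theorem norm_dftMatrix_apply_sq (j k : Fin N) : ‖dftMatrix N j k‖ ^ 2 = 1 / N := by
  have : Complex.exp (-(2 * Real.pi * Complex.I * ((j : ℕ) : ℂ) * ((k : ℕ) : ℂ) / (N : ℂ))) =
      Complex.exp ((-(2 * Real.pi * (j : ℕ) * (k : ℕ) / N) : ℝ) * Complex.I) := by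
    congr 1
    push_cast
    ring
  rw [dftMatrix, Matrix.of_apply, this, norm_mul, Complex.norm_exp_ofReal_mul_I, mul_one,
    Complex.norm_real, Real.norm_of_nonneg (by positivity), div_pow, one_pow,
    Real.sq_sqrt (by positivity)]

theorem dftMatrix_mem_unitaryGroup (N : ℕ) : dftMatrix N ∈ Matrix.unitaryGroup (Fin N) ℂ := by
  rcases Nat.eq_zero_or_pos N with rfl | hN
  · rw [Matrix.mem_unitaryGroup_iff]
    exact Subsingleton.elim _ _
  have hN' : (N : ℂ) ≠ 0 := by exact_mod_cast hN.ne'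
  have hsq : ((1 / Real.sqrt N : ℝ) : ℂ) * ((1 / Real.sqrt N : ℝ) : ℂ) = 1 / N := by
    rw [← Complex.ofReal_mul, div_mul_div_comm, Real.mul_self_sqrt (by positivity)]
    push_cast
    ring
  set ζ := Complex.exp (2 * Real.pi * Complex.I / N) with hζ
  have hprim : IsPrimitiveRoot ζ N := Complex.isPrimitiveRoot_exp N hN.ne'
  rw [Matrix.mem_unitaryGroup_iff]
  ext i l
  rw [Matrix.mul_apply]
  have hterm : ∀ k : Fin N, dftMatrix N i k * star (dftMatrix N) k l =
      1 / N * (ζ ^ ((l : ℤ) - (i : ℤ))) ^ (k : ℕ) := by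
    intro k
    rw [Matrix.star_apply, dftMatrix, Matrix.of_apply, Matrix.of_apply, star_mul']
    have e1 : star ((1 / Real.sqrt N : ℝ) : ℂ) = ((1 / Real.sqrt N : ℝ) : ℂ) :=
      Complex.conj_ofReal _
    rw [e1, mul_mul_mul_comm, hsq]
    congr 1
    rw [Complex.star_def, ← Complex.exp_conj, ← Complex.exp_add, hζ, ← Complex.exp_int_mul,
      ← Complex.exp_nat_mul]
    congr 1
    simp only [map_neg, map_div₀, map_mul, Complex.conj_ofReal, Complex.conj_I, map_natCast,
      map_ofNat]
    push_cast
    ring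
  rw [Finset.sum_congr rfl fun k _ => hterm k, ← Finset.mul_sum,
    Fin.sum_univ_eq_sum_range (fun k => (ζ ^ ((l : ℤ) - (i : ℤ))) ^ k) N]
  by_cases hil : i = l
  · subst hil
    simp [hN']
  · rw [Matrix.one_apply_ne hil]
    have hne : ζ ^ ((l : ℤ) - (i : ℤ)) ≠ 1 := by
      intro h
      rw [hprim.zpow_eq_one_iff_dvd] at h
      apply hil
      obtain ⟨c, hc⟩ := h
      have h1 := i.2
      have h2 := l.2
      have hc0 : c = 0 := by
        by_contra hcne
        have h3 : (N : ℤ) ≤ |(N : ℤ) * c| := by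
          rw [abs_mul, Nat.abs_cast]
          exact le_mul_of_one_le_right (by positivity) (Int.one_le_abs hcne)
        rw [← hc] at h3
        have : |((l : ℕ) : ℤ) - ((i : ℕ) : ℤ)| < N := by rw [abs_lt]; omega
        omega
      rw [hc0] at hc
      exact Fin.ext (by omega)
    have hpow : (ζ ^ ((l : ℤ) - (i : ℤ))) ^ N = 1 := by
      rw [← zpow_natCast, zpow_comm, zpow_natCast, hprim.pow_eq_one, one_zpow]
    rw [geom_sum_eq hne, hpow]
    simp

end Spectra

/-! ### Riemann sums -/

theorem tendsto_riemannSum {g : ℝ → ℝ} (hg : Continuous g) {T : ℝ} (hT : 0 < T) :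
    Tendsto (fun N : ℕ => 1 / (N : ℝ) * ∑ j : Fin N, g (T * j / N)) atTop
      (𝓝 (1 / T * ∫ x in (0 : ℝ)..T, g x)) := by
  rw [Metric.tendsto_atTop]
  intro ε hε
  obtain ⟨δ, hδ, hunif⟩ := Metric.uniformContinuousOn_iff.1
    (isCompact_Icc.uniformContinuousOn_of_continuous (hg.continuousOn (s := Set.Icc 0 T)))
    (ε / 2) (by positivity)
  obtain ⟨N₀, hN₀⟩ := exists_nat_gt (T / δ)
  refine ⟨max N₀ 1, fun N hN => ?_⟩
  have hN1 : 1 ≤ N := (le_max_right _ _).trans hN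
  have hNpos : (0 : ℝ) < N := by exact_mod_cast hN1
  have hstep : T / N < δ := by
    rw [div_lt_iff₀ hNpos]
    have h1 : (N₀ : ℝ) ≤ N := by exact_mod_cast (le_max_left _ _).trans hN
    have := (div_lt_iff₀ hδ).1 (hN₀.trans_le h1)
    linarith
  let x : ℕ → ℝ := fun j => T * j / N
  have hx : ∀ j, x (j + 1) - x j = T / N := fun j => by
    simp only [x]; push_cast; ring
  have hsum : ∫ y in (0 : ℝ)..T, g y = ∑ j ∈ Finset.range N, ∫ y in x j..x (j + 1), g y := by
    rw [intervalIntegral.sum_integral_adjacent_intervals fun j _ => hg.intervalIntegrable _ _]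
    congr 1
    · simp [x]
    · simp only [x]; field_simp
  have hpiece : ∀ j ∈ Finset.range N,
      |T / N * g (x j) - ∫ y in x j..x (j + 1), g y| ≤ ε / 2 * (T / N) := by
    intro j hj
    have hjN : j + 1 ≤ N := Finset.mem_range.1 hj
    have hconst : T / N * g (x j) = ∫ y in x j..x (j + 1), g (x j) := by
      rw [intervalIntegral.integral_const, hx, smul_eq_mul]
    have hle : x j ≤ x (j + 1) := by
      have := hx j
      have : 0 < T / N := by positivity
      linarith
    rw [hconst, ← intervalIntegral.integral_sub (by simp) (hg.intervalIntegrable _ _)]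
    have := intervalIntegral.norm_integral_le_of_norm_le_const (a := x j) (b := x (j + 1))
      (f := fun y => g (x j) - g y) (C := ε / 2) (fun y hy => ?_)
    · rwa [hx, abs_of_pos (by positivity), Real.norm_eq_abs] at this
    rw [Set.uIoc_of_le hle] at hy
    have hx0 : 0 ≤ x j := by positivity
    have hx1 : x (j + 1) ≤ T := by
      simp only [x]
      rw [div_le_iff₀ hNpos]
      have : ((j + 1 : ℕ) : ℝ) ≤ N := by exact_mod_cast hjN
      gcongr
    have hd := hunif (x j) ⟨hx0, hle.trans hx1⟩ y ⟨hx0.trans hy.1.le, hy.2.trans hx1⟩ (by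
      rw [Real.dist_eq, abs_sub_comm, abs_of_pos (by linarith [hy.1])]
      linarith [hy.2, hx j])
    rw [Real.dist_eq] at hd
    exact hd.le
  have hfin : |∑ j ∈ Finset.range N, (T / N * g (x j)) - ∫ y in (0 : ℝ)..T, g y| ≤ ε / 2 * T := by
    rw [hsum, ← Finset.sum_sub_distrib]
    refine (Finset.abs_sum_le_sum_abs _ _).trans ((Finset.sum_le_sum hpiece).trans ?_)
    rw [Finset.sum_const, Finset.card_range, nsmul_eq_mul]
    apply le_of_eq
    field_simp
  rw [Real.dist_eq]
  have e : 1 / (N : ℝ) * ∑ j : Fin N, g (T * j / N) - 1 / T * ∫ x in (0 : ℝ)..T, g x =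
      1 / T * (∑ j ∈ Finset.range N, (T / N * g (x j)) - ∫ y in (0 : ℝ)..T, g y) := by
    rw [Fin.sum_univ_eq_sum_range (fun j => g (T * j / N)) N, ← Finset.mul_sum]
    simp only [x]
    field_simp
  rw [e, abs_mul, abs_of_pos (by positivity)]
  calc 1 / T * _ ≤ 1 / T * (ε / 2 * T) := by gcongr
    _ = ε / 2 := by field_simp
    _ < ε := by linarith

/-! ### Fourier series and Toeplitz matrices -/

section Toeplitz

variable {σ : ℤ → ℂ}

theorem hasSum_fourierSeriesL2 (hσ : Summable fun k => ‖σ k‖ ^ 2) :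
    HasSum (fun k : ℤ => σ k • (fourierLp 2 (-k) :
      Lp ℂ 2 (@AddCircle.haarAddCircle (2 * Real.pi) _))) (fourierSeriesL2 σ) := by
  have hmem : Memℓp (fun k : ℤ => σ (-k)) 2 := by
    rw [memℓp_gen_iff (by norm_num)]
    have := (Equiv.neg ℤ).summable_iff (f := fun k => ‖σ k‖ ^ 2) |>.2 hσ
    simpa [Function.comp_def] using this
  have h := (fourierBasis (T := 2 * Real.pi)).hasSum_repr_symm ⟨_, hmem⟩
  rw [coe_fourierBasis] at h
  have h2 := (Equiv.neg ℤ).hasSum_iff.2 h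
  simp only [Function.comp_def, Equiv.neg_apply, neg_neg] at h2
  exact h2.summable.hasSum

theorem integral_fourier_mul_fourierSeriesL2 (hσ : Summable fun k => ‖σ k‖ ^ 2) (n : ℤ) :
    ∫ z, fourier n z * fourierSeriesL2 σ z ∂(@AddCircle.haarAddCircle (2 * Real.pi) _) = σ n := by
  have h1 := fourierBasis_repr (fourierSeriesL2 σ) (-n)
  rw [fourierCoeff, neg_neg] at h1
  simp_rw [smul_eq_mul] at h1
  rw [← h1, HilbertBasis.repr_apply_apply, coe_fourierBasis]
  have h2 := (hasSum_fourierSeriesL2 hσ).mapL (innerSL ℂ (fourierLp 2 (-n) :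
      Lp ℂ 2 (@AddCircle.haarAddCircle (2 * Real.pi) _)))
  have h3 : (fun k : ℤ => innerSL ℂ (fourierLp 2 (-n) :
      Lp ℂ 2 (@AddCircle.haarAddCircle (2 * Real.pi) _)) (σ k • fourierLp 2 (-k))) =
      fun k => if k = n then σ n else 0 := by
    funext k
    rw [innerSL_apply_apply, inner_smul_right,
      orthonormal_iff_ite.1 (orthonormal_fourier (T := 2 * Real.pi))]
    by_cases hk : k = n
    · simp [hk]
    · simp [hk, Ne.symm hk]
  rw [h3] at h2
  exact h2.unique (hasSum_ite_eq n (σ n))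

theorem integrable_Lp_two_haarAddCircle (g : Lp ℂ 2 (@AddCircle.haarAddCircle (2 * Real.pi) _)) :
    Integrable g AddCircle.haarAddCircle :=
  (Lp.memLp g).integrable (by norm_num)

/-- Toeplitz quadratic forms: with `q = ∑ conj (x m) e^{imω}`, the form of the matrix of Fourier
coefficients of `g` at `x` is the integral of `g |q|²`. -/
theorem sum_sum_star_mul_integral_fourier_mul {N : ℕ} {g : AddCircle (2 * Real.pi) → ℂ}
    (hg : Integrable g AddCircle.haarAddCircle) (x : Fin N → ℂ) :
    ∑ m : Fin N, ∑ n : Fin N, star (x m) * (∫ z, fourier ((m : ℤ) - (n : ℤ)) z * g z ∂AddCircle.haarAddCircle) * x n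
      = ∫ z, ((‖∑ m : Fin N, star (x m) * fourier (m : ℤ) z‖ ^ 2 : ℝ) : ℂ) * g z
          ∂AddCircle.haarAddCircle := by
  have hint : ∀ n : ℤ, Integrable (fun z => fourier n z * g z) AddCircle.haarAddCircle := fun n =>
    hg.fourier_smul n
  have hpt : ∀ z : AddCircle (2 * Real.pi),
      ((‖∑ m : Fin N, star (x m) * fourier (m : ℤ) z‖ ^ 2 : ℝ) : ℂ) * g z =
        ∑ m : Fin N, ∑ n : Fin N,
          star (x m) * x n * (fourier ((m : ℤ) - (n : ℤ)) z * g z) := by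
    intro z
    rw [← Complex.normSq_eq_norm_sq, ← Complex.mul_conj, map_sum, Finset.sum_mul_sum,
      Finset.sum_mul]
    refine Finset.sum_congr rfl fun m _ => ?_
    rw [Finset.sum_mul]
    refine Finset.sum_congr rfl fun n _ => ?_
    rw [sub_eq_add_neg, fourier_add, fourier_neg, map_mul, Complex.star_def,
      Complex.conj_conj]
    ring
  simp_rw [hpt]
  rw [integral_finsetSum _ fun m _ => integrable_finsetSum _ fun n _ => (hint _).const_mul _]
  refine Finset.sum_congr rfl fun m _ => ?_
  rw [integral_finsetSum _ fun n _ => (hint _).const_mul _]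
  refine Finset.sum_congr rfl fun n _ => ?_
  rw [integral_const_mul]
  ring

/-- The spectrum of a Toeplitz covariance matrix lies above the essential infimum of its symbol. -/
theorem le_of_isEigenDecomp_toeplitzCov (hσ : Summable fun k => ‖σ k‖ ^ 2) {δ : ℝ}
    (hδ : ∀ᵐ z ∂(@AddCircle.haarAddCircle (2 * Real.pi) _), δ ≤ (fourierSeriesL2 σ z).re) {N : ℕ}
    {W : Matrix (Fin N) (Fin N) ℂ} {lam : Fin N → ℝ}
    (hW : IsEigenDecomp (toeplitzCov σ N) W lam) (i : Fin N) : δ ≤ lam i := by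
  set x : Fin N → ℂ := fun m => W m i with hx
  have hWW : W.conjTranspose * W = 1 := Matrix.mem_unitaryGroup_iff'.1 hW.unitary
  have hlam : ∑ m, ∑ n, star (x m) * toeplitzCov σ N m n * x n = lam i := by
    have h1 : W.conjTranspose * toeplitzCov σ N * W =
        Matrix.diagonal (fun i => (lam i : ℂ)) := by
      rw [hW.eq, ← Matrix.mul_assoc, ← Matrix.mul_assoc, hWW, Matrix.one_mul, Matrix.mul_assoc,
        hWW, Matrix.mul_one]
    have h2 := congrFun (congrFun h1 i) i
    rw [Matrix.diagonal_apply_eq, Matrix.mul_apply] at h2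
    rw [← h2, Finset.sum_comm]
    refine Finset.sum_congr rfl fun n _ => ?_
    rw [Matrix.mul_apply, Finset.sum_mul]
    rfl
  set q : AddCircle (2 * Real.pi) → ℝ := fun z =>
    ‖∑ m : Fin N, star (x m) * fourier (m : ℤ) z‖ ^ 2 with hq
  have hS := integrable_Lp_two_haarAddCircle (fourierSeriesL2 σ)
  have hqc : Continuous q := by fun_prop
  have hqS : Integrable (fun z => (q z : ℂ) * fourierSeriesL2 σ z)
      (@AddCircle.haarAddCircle (2 * Real.pi) _) := by
    obtain ⟨C, hC⟩ := isCompact_univ.exists_bound_of_continuousOn hqc.continuousOn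
    refine hS.bdd_mul (c := C) (by fun_prop) (Eventually.of_forall fun z => ?_)
    simpa using hC z trivial
  have e1 := sum_sum_star_mul_integral_fourier_mul hS x
  simp_rw [integral_fourier_mul_fourierSeriesL2 hσ] at e1
  have e2 := sum_sum_star_mul_integral_fourier_mul
    (integrable_const (1 : ℂ) (μ := @AddCircle.haarAddCircle (2 * Real.pi) _)) x
  have hq1 : ∫ z, q z ∂(@AddCircle.haarAddCircle (2 * Real.pi) _) = 1 := by
    have h0 : ∀ n : ℤ, ∫ z, fourier n z ∂(@AddCircle.haarAddCircle (2 * Real.pi) _) =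
        if n = 0 then 1 else 0 := by
      intro n
      have := congrFun (fourierCoeff_fourier (T := 2 * Real.pi) n) 0
      simp only [fourierCoeff, neg_zero, fourier_zero, one_smul] at this
      rw [this, Pi.single_apply]
      simp [eq_comm]
    simp only [mul_one, h0, sub_eq_zero, Nat.cast_inj, ← Fin.ext_iff] at e2
    have h1 : ∑ m, star (x m) * x m = 1 := by
      have := congrFun (congrFun hWW i) i
      rwa [Matrix.mul_apply, Matrix.one_apply_eq] at this
    rw [integral_complex_ofReal] at e2
    apply Complex.ofReal_injective
    rw [← e2]
    simpa using h1
  have e3 : lam i = ∫ z, q z * (fourierSeriesL2 σ z).re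
      ∂(@AddCircle.haarAddCircle (2 * Real.pi) _) := by
    have h1 : (lam i : ℂ) = ∫ z, (q z : ℂ) * fourierSeriesL2 σ z
        ∂(@AddCircle.haarAddCircle (2 * Real.pi) _) := hlam.symm.trans e1
    have h2 := Complex.reCLM.integral_comp_comm hqS
    rw [← h1] at h2
    simpa using h2.symm
  rw [e3, ← mul_one δ, ← hq1, ← integral_const_mul]
  refine integral_mono_ae ?_ ?_ ?_
  · exact (hqc.integrable_of_hasCompactSupport (HasCompactSupport.of_compactSpace _)).const_mul δ
  · simpa using hqS.re
  · filter_upwards [hδ] with z hz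
    rw [mul_comm]
    exact mul_le_mul_of_nonneg_left hz (by positivity)

theorem integral_norm_le_norm_Lp_two (g : Lp ℂ 2 (@AddCircle.haarAddCircle (2 * Real.pi) _)) :
    ∫ z, ‖g z‖ ∂(@AddCircle.haarAddCircle (2 * Real.pi) _) ≤ ‖g‖ := by
  rw [Lp.norm_def, integral_norm_eq_lintegral_enorm (Lp.aestronglyMeasurable g),
    ← eLpNorm_one_eq_lintegral_enorm]
  exact ENNReal.toReal_mono (Lp.eLpNorm_ne_top g)
    (eLpNorm_le_eLpNorm_of_exponent_le (by norm_num) (Lp.aestronglyMeasurable g))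

/-- The partial sum of the Fourier series `∑ σ k e^{-ikω}` over a finite set of frequencies. -/
noncomputable def fourierPartialSum (σ : ℤ → ℂ) (A : Finset ℤ) : C(AddCircle (2 * Real.pi), ℂ) :=
  ∑ k ∈ A, σ k • fourier (-k)

theorem fourierPartialSum_coe_apply (A : Finset ℤ) (ω : ℝ) :
    fourierPartialSum σ A (ω : AddCircle (2 * Real.pi)) =
      ∑ k ∈ A, σ k * Complex.exp (-(k * ω) * Complex.I) := by
  rw [fourierPartialSum, ContinuousMap.sum_apply]
  refine Finset.sum_congr rfl fun k _ => ?_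
  rw [ContinuousMap.smul_apply, fourier_coe_apply, smul_eq_mul]
  congr 2
  have : (Real.pi : ℂ) ≠ 0 := by exact_mod_cast Real.pi_ne_zero
  push_cast
  field_simp

theorem tendsto_toLp_fourierPartialSum (hσ : Summable fun k => ‖σ k‖ ^ 2) :
    Tendsto (fun A => ContinuousMap.toLp (E := ℂ) 2 AddCircle.haarAddCircle ℂ
      (fourierPartialSum σ A)) atTop (𝓝 (fourierSeriesL2 σ)) := by
  have h : (fun A => ContinuousMap.toLp (E := ℂ) 2 AddCircle.haarAddCircle ℂ
      (fourierPartialSum σ A)) = fun A : Finset ℤ => ∑ k ∈ A, σ k • (fourierLp 2 (-k) :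
      Lp ℂ 2 (@AddCircle.haarAddCircle (2 * Real.pi) _)) := by
    funext A
    rw [fourierPartialSum, map_sum]
    simp_rw [map_smul]
  rw [h]
  simpa [HasSum] using hasSum_fourierSeriesL2 hσ

end Toeplitz

section Szego

variable {σ : ℤ → ℂ}

/-- The part of a Toeplitz matrix with frequencies outside `A` has squared Frobenius norm at most
`N` times the energy of these frequencies. -/
theorem sum_sum_norm_sq_toeplitz_sub_le (hσ : Summable fun k => ‖σ k‖ ^ 2) (A : Finset ℤ) (N : ℕ) :
    ∑ m, ∑ n, ‖(toeplitzCov σ N - toeplitzCov (fun k => if k ∈ A then σ k else 0) N) m n‖ ^ 2 ≤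
      N * (∑' k, ‖σ k‖ ^ 2 - ∑ k ∈ A, ‖σ k‖ ^ 2) := by
  set g : ℤ → ℝ := fun k => if k ∈ A then 0 else ‖σ k‖ ^ 2 with hg
  have hg0 : ∀ k, 0 ≤ g k := fun k => by simp only [hg]; split_ifs <;> positivity
  have hgs : HasSum g (∑' k, ‖σ k‖ ^ 2 - ∑ k ∈ A, ‖σ k‖ ^ 2) := by
    have h1 : HasSum (fun k => if k ∈ A then ‖σ k‖ ^ 2 else 0) (∑ k ∈ A, ‖σ k‖ ^ 2) := by
      rw [← Finset.sum_congr rfl fun k (hk : k ∈ A) => if_pos hk]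
      exact hasSum_sum_of_ne_finset_zero fun b hb => if_neg hb
    have h2 : g = fun k => ‖σ k‖ ^ 2 - if k ∈ A then ‖σ k‖ ^ 2 else 0 := by
      funext k
      simp only [hg]
      split_ifs <;> simp
    rw [h2]
    exact hσ.hasSum.sub h1
  have hrow : ∀ m : Fin N, ∑ n : Fin N, g ((m : ℤ) - (n : ℤ)) ≤
      ∑' k, ‖σ k‖ ^ 2 - ∑ k ∈ A, ‖σ k‖ ^ 2 := by
    intro m
    have hinj : Set.InjOn (fun n : Fin N => (m : ℤ) - (n : ℤ)) (Finset.univ : Finset (Fin N)) := by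
      intro a _ b _ hab
      exact Fin.ext (by simp only at hab; omega)
    rw [← Finset.sum_image (f := g) hinj]
    exact sum_le_hasSum _ (fun k _ => hg0 k) hgs
  calc _ = ∑ m : Fin N, ∑ n : Fin N, g ((m : ℤ) - (n : ℤ)) := by
        refine Finset.sum_congr rfl fun m _ => Finset.sum_congr rfl fun n _ => ?_
        simp only [Matrix.sub_apply, toeplitzCov, Matrix.of_apply, hg]
        split_ifs <;> simp
    _ ≤ ∑ _m : Fin N, (∑' k, ‖σ k‖ ^ 2 - ∑ k ∈ A, ‖σ k‖ ^ 2) := Finset.sum_le_sum fun m _ => hrow m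
    _ = _ := by rw [Finset.sum_const, Finset.card_univ, Fintype.card_fin, nsmul_eq_mul]

theorem card_filter_boundary_le (N M : ℕ) :
    (Finset.univ.filter fun m : Fin N => (m : ℕ) < M ∨ N ≤ m + M).card ≤ 2 * M := by
  rw [Finset.filter_or, two_mul]
  refine (Finset.card_union_le _ _).trans (add_le_add ?_ ?_)
  · refine (Finset.card_le_card_of_injOn (t := Finset.range M) (fun m : Fin N => (m : ℕ)) ?_ ?_).trans
      (Finset.card_range M).le
    · intro m hm
      simpa using hm
    · exact fun a _ b _ h => Fin.ext h
  · refine (Finset.card_le_card_of_injOn (t := Finset.range M) (fun m : Fin N => N - 1 - (m : ℕ))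
      ?_ ?_).trans (Finset.card_range M).le
    · intro m hm
      have h2 := m.2
      simp only [Finset.coe_filter, Finset.mem_univ, true_and, Set.mem_ofPred_eq] at hm
      simp only [Finset.coe_range, Set.mem_Iio]
      omega
    · intro a _ b _ h
      have h1 := a.2
      have h2 := b.2
      simp only at h
      exact Fin.ext (by omega)

/-- The discrete Fourier vectors are approximate eigenvectors of a banded Toeplitz matrix, with
the values of its symbol at the points `2πj/N` as approximate eigenvalues: all rows are exact,
except those within the bandwidth `M` of the boundary. -/
theorem sum_sum_norm_sq_toeplitz_mul_dft_sub_le (A : Finset ℤ) {M : ℕ} (hM : ∀ k ∈ A, |k| ≤ M)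
    (N : ℕ) :
    ∑ m, ∑ j, ‖(toeplitzCov (fun k => if k ∈ A then σ k else 0) N * (dftMatrix N).conjTranspose -
      (dftMatrix N).conjTranspose * Matrix.diagonal fun j : Fin N =>
        fourierPartialSum σ A ((2 * Real.pi * (j : ℕ) / N : ℝ) : AddCircle (2 * Real.pi))) m j‖ ^ 2
      ≤ 2 * M * (∑ k ∈ A, ‖σ k‖) ^ 2 := by
  classical
  set E : Fin N → ℤ → ℂ := fun j k =>
    Complex.exp (-(k * (2 * Real.pi * (j : ℕ) / N : ℝ)) * Complex.I) with hE
  have hEnorm : ∀ j k, ‖E j k‖ = 1 := by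
    intro j k
    have : E j k = Complex.exp ((-(k * (2 * Real.pi * (j : ℕ) / N)) : ℝ) * Complex.I) := by
      simp only [hE]
      push_cast
      rfl
    rw [this, Complex.norm_exp_ofReal_mul_I]
  set U := (dftMatrix N).conjTranspose with hU
  have hUu : U ∈ Matrix.unitaryGroup (Fin N) ℂ :=
    Unitary.star_mem (dftMatrix_mem_unitaryGroup N)
  have hUE : ∀ n m j : Fin N, U n j = U m j * E j ((m : ℤ) - (n : ℤ)) := by
    intro n m j
    simp only [hU, hE, Matrix.conjTranspose_apply, dftMatrix, Matrix.of_apply, star_mul']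
    rw [mul_assoc (star ((1 / Real.sqrt N : ℝ) : ℂ))]
    congr 1
    rw [Complex.star_def, ← Complex.exp_conj, ← Complex.exp_conj,
      ← Complex.exp_add]
    congr 1
    simp only [map_neg, map_div₀, map_mul, Complex.conj_ofReal, Complex.conj_I, map_natCast,
      map_ofNat]
    push_cast
    ring
  have hentry : ∀ m j : Fin N, (toeplitzCov (fun k => if k ∈ A then σ k else 0) N * U -
      U * Matrix.diagonal fun j : Fin N => fourierPartialSum σ A
        ((2 * Real.pi * (j : ℕ) / N : ℝ) : AddCircle (2 * Real.pi))) m j =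
      U m j * (∑ n : Fin N, (if (m : ℤ) - (n : ℤ) ∈ A then σ ((m : ℤ) - (n : ℤ)) else 0) *
        E j ((m : ℤ) - (n : ℤ)) - ∑ k ∈ A, σ k * E j k) := by
    intro m j
    rw [Matrix.sub_apply, Matrix.mul_diagonal, Matrix.mul_apply, fourierPartialSum_coe_apply,
      mul_sub]
    congr 1
    rw [Finset.mul_sum]
    refine Finset.sum_congr rfl fun n _ => ?_
    rw [toeplitzCov, Matrix.of_apply, hUE n m j]
    ring
  -- `I m` is the set of frequencies that row `m` of the matrix sees
  set I : Fin N → Finset ℤ := fun m => Finset.univ.image fun n : Fin N => (m : ℤ) - (n : ℤ) with hI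
  have hmiss : ∀ m j : Fin N,
      ∑ n : Fin N, (if (m : ℤ) - (n : ℤ) ∈ A then σ ((m : ℤ) - (n : ℤ)) else 0) *
        E j ((m : ℤ) - (n : ℤ)) - ∑ k ∈ A, σ k * E j k = -∑ k ∈ A \ I m, σ k * E j k := by
    intro m j
    have hinj : Set.InjOn (fun n : Fin N => (m : ℤ) - (n : ℤ)) (Finset.univ : Finset (Fin N)) := by
      intro a _ b _ hab
      exact Fin.ext (by simp only at hab; omega)
    rw [← Finset.sum_image (f := fun k => (if k ∈ A then σ k else 0) * E j k) hinj]
    simp_rw [ite_mul, zero_mul]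
    rw [Finset.sum_ite_mem, Finset.inter_comm, ← Finset.sum_inter_add_sum_sdiff A (I m)]
    ring
  have hrow : ∀ m : Fin N, ∑ k ∈ A \ I m, ‖σ k‖ ≤
      if (m : ℕ) < M ∨ N ≤ m + M then ∑ k ∈ A, ‖σ k‖ else 0 := by
    intro m
    split_ifs with hm
    · exact Finset.sum_le_sum_of_subset_of_nonneg Finset.sdiff_subset fun _ _ _ => norm_nonneg _
    · have : A \ I m = ∅ := by
        rw [Finset.sdiff_eq_empty_iff_subset]
        intro k hk
        have hkM := abs_le.1 (hM k hk)
        rw [not_or, not_lt, not_le] at hm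
        have hlt : ((m : ℤ) - k).toNat < N := by omega
        refine Finset.mem_image.2 ⟨⟨_, hlt⟩, Finset.mem_univ _, ?_⟩
        simp only
        omega
      rw [this, Finset.sum_empty]
  have hbound : ∀ m j : Fin N, ‖(toeplitzCov (fun k => if k ∈ A then σ k else 0) N * U -
      U * Matrix.diagonal fun j : Fin N => fourierPartialSum σ A
        ((2 * Real.pi * (j : ℕ) / N : ℝ) : AddCircle (2 * Real.pi))) m j‖ ^ 2 ≤
      ‖U m j‖ ^ 2 * (if (m : ℕ) < M ∨ N ≤ m + M then (∑ k ∈ A, ‖σ k‖) ^ 2 else 0) := by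
    intro m j
    rw [hentry, hmiss, norm_mul, norm_neg, mul_pow]
    have h1 : ‖∑ k ∈ A \ I m, σ k * E j k‖ ≤
        if (m : ℕ) < M ∨ N ≤ m + M then ∑ k ∈ A, ‖σ k‖ else 0 := by
      refine (norm_sum_le _ _).trans (le_trans (le_of_eq ?_) (hrow m))
      exact Finset.sum_congr rfl fun k _ => by rw [norm_mul, hEnorm, mul_one]
    refine mul_le_mul_of_nonneg_left ?_ (by positivity)
    refine (pow_le_pow_left₀ (norm_nonneg _) h1 2).trans (le_of_eq ?_)
    split_ifs <;> simp
  calc _ ≤ ∑ m : Fin N, ∑ j : Fin N, ‖U m j‖ ^ 2 *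
        (if (m : ℕ) < M ∨ N ≤ m + M then (∑ k ∈ A, ‖σ k‖) ^ 2 else 0) :=
        Finset.sum_le_sum fun m _ => Finset.sum_le_sum fun j _ => hbound m j
    _ = ∑ m : Fin N, (if (m : ℕ) < M ∨ N ≤ m + M then (∑ k ∈ A, ‖σ k‖) ^ 2 else 0) := by
        refine Finset.sum_congr rfl fun m _ => ?_
        rw [← Finset.sum_mul, sum_norm_sq_row_of_mem_unitaryGroup hUu, one_mul]
    _ = (Finset.univ.filter fun m : Fin N => (m : ℕ) < M ∨ N ≤ m + M).card *
          (∑ k ∈ A, ‖σ k‖) ^ 2 := by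
        rw [← Finset.sum_filter, Finset.sum_const, nsmul_eq_mul]
    _ ≤ _ := by
        gcongr
        exact_mod_cast card_filter_boundary_le N M

end Szego

/-! ### Szegő's limit theorem -/

section SzegoLimit

variable {σ : ℤ → ℂ}

theorem sum_sum_norm_sq_mul_unitary {N : ℕ} {U : Matrix (Fin N) (Fin N) ℂ}
    (hU : U ∈ Matrix.unitaryGroup (Fin N) ℂ) (A : Matrix (Fin N) (Fin N) ℂ) :
    ∑ i, ∑ j, ‖(A * U) i j‖ ^ 2 = ∑ i, ∑ j, ‖A i j‖ ^ 2 := by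
  have h : U * U.conjTranspose = 1 := Matrix.mem_unitaryGroup_iff.1 hU
  apply Complex.ofReal_injective
  rw [sum_sum_norm_sq_eq_trace, sum_sum_norm_sq_eq_trace, Matrix.conjTranspose_mul,
    Matrix.mul_assoc, Matrix.trace_mul_comm, Matrix.mul_assoc, Matrix.mul_assoc, h, Matrix.mul_one]

theorem integral_haarAddCircle_eq_intervalIntegral (F : AddCircle (2 * Real.pi) → ℝ) :
    ∫ z, F z ∂AddCircle.haarAddCircle =
      1 / (2 * Real.pi) * ∫ ω in (0 : ℝ)..(2 * Real.pi), F ω := by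
  rw [AddCircle.integral_haarAddCircle, ← AddCircle.intervalIntegral_preimage (2 * Real.pi) 0,
    zero_add, smul_eq_mul, one_div]

theorem integrable_lipschitz_comp_re {f : ℝ → ℝ} {K : ℝ}
    (hf : ∀ x y, |f x - f y| ≤ K * |x - y|) {g : AddCircle (2 * Real.pi) → ℂ}
    (hg : Integrable g AddCircle.haarAddCircle) :
    Integrable (fun z => f (g z).re) AddCircle.haarAddCircle := by
  have hfc : Continuous f := by
    have : LipschitzWith K.toNNReal f := LipschitzWith.of_dist_le_mul fun x y => by
      rw [Real.dist_eq, Real.dist_eq]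
      exact (hf x y).trans (mul_le_mul_of_nonneg_right (Real.le_coe_toNNReal K) (abs_nonneg _))
    exact this.continuous
  refine ((integrable_const |f 0|).add (hg.re.abs.const_mul K)).mono'
    (hfc.comp_aestronglyMeasurable hg.re.aestronglyMeasurable) (Eventually.of_forall fun z => ?_)
  have h1 := hf (g z).re 0
  have h2 := abs_sub_abs_le_abs_sub (f (g z).re) (f 0)
  rw [sub_zero] at h1
  rw [Real.norm_eq_abs]
  simp only [Pi.add_apply, RCLike.re_to_complex]
  linarith

/-- **Szegő's limit theorem** for square-integrable symbols and Lipschitz test functions, uniformly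
over the choice of eigenvalue decompositions. The symbol is approximated in `L²` by a partial sum
of its Fourier series; for the latter the discrete Fourier basis is almost an eigenbasis. -/
theorem eventually_abs_average_eigenvalues_sub_le (hσ : Summable fun k => ‖σ k‖ ^ 2) {f : ℝ → ℝ}
    {K : ℝ} (hK : 0 ≤ K) (hf : ∀ x y, |f x - f y| ≤ K * |x - y|) {ε : ℝ} (hε : 0 < ε) :
    ∀ᶠ N : ℕ in atTop, ∀ (W : Matrix (Fin N) (Fin N) ℂ) (lam : Fin N → ℝ),
      IsEigenDecomp (toeplitzCov σ N) W lam →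
      |1 / (N : ℝ) * ∑ i, f (lam i) -
        ∫ z, f (fourierSeriesL2 σ z).re ∂(@AddCircle.haarAddCircle (2 * Real.pi) _)| ≤ ε := by
  -- the three errors below add up to `(3 * K + 1) * η`
  set η := ε / (4 * (K + 1)) with hη
  have hη0 : 0 < η := by positivity
  have hfc : Continuous f := by
    have : LipschitzWith K.toNNReal f := LipschitzWith.of_dist_le_mul fun x y => by
      rw [Real.dist_eq, Real.dist_eq]
      exact (hf x y).trans (mul_le_mul_of_nonneg_right (Real.le_coe_toNNReal K) (abs_nonneg _))
    exact this.continuous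
  obtain ⟨A, hA1, hA2⟩ : ∃ A : Finset ℤ,
      ‖ContinuousMap.toLp (E := ℂ) 2 AddCircle.haarAddCircle ℂ (fourierPartialSum σ A) -
        fourierSeriesL2 σ‖ ≤ η ∧ ∑' k, ‖σ k‖ ^ 2 - ∑ k ∈ A, ‖σ k‖ ^ 2 ≤ η ^ 2 := by
    have h1 := (tendsto_toLp_fourierPartialSum hσ).eventually (Metric.closedBall_mem_nhds _ hη0)
    have h2 : Tendsto (fun A : Finset ℤ => ∑ k ∈ A, ‖σ k‖ ^ 2) atTop (𝓝 (∑' k, ‖σ k‖ ^ 2)) := by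
      simpa [HasSum] using hσ.hasSum
    have h3 := h2.eventually (Metric.closedBall_mem_nhds _ (show 0 < η ^ 2 by positivity))
    obtain ⟨A, hA1, hA2⟩ := (h1.and h3).exists
    refine ⟨A, by simpa [dist_eq_norm] using hA1, ?_⟩
    rw [Real.dist_eq, abs_sub_comm] at hA2
    exact (le_abs_self _).trans hA2
  obtain ⟨M, hM⟩ : ∃ M : ℕ, ∀ k ∈ A, |k| ≤ M :=
    ⟨A.sup Int.natAbs, fun k hk => by
      have : k.natAbs ≤ A.sup Int.natAbs := Finset.le_sup (f := Int.natAbs) hk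
      rw [Int.abs_eq_natAbs]
      exact_mod_cast this⟩
  set C := ∑ k ∈ A, ‖σ k‖ with hC
  set p := fourierPartialSum σ A with hp
  set μ : Measure (AddCircle (2 * Real.pi)) := AddCircle.haarAddCircle with hμ
  have hg : Continuous fun ω : ℝ => f (p (ω : AddCircle (2 * Real.pi))).re := by
    have : Continuous fun ω : ℝ => (ω : AddCircle (2 * Real.pi)) := AddCircle.continuous_mk' _
    fun_prop
  have hR := (tendsto_riemannSum hg Real.two_pi_pos).eventually
    (Metric.closedBall_mem_nhds _ hη0)
  have hpint : Integrable p μ :=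
    (map_continuous p).integrable_of_hasCompactSupport (HasCompactSupport.of_compactSpace _)
  have hSint := integrable_Lp_two_haarAddCircle (fourierSeriesL2 σ)
  have hL1 : |∫ z, f (p z).re ∂μ - ∫ z, f (fourierSeriesL2 σ z).re ∂μ| ≤ K * η := by
    rw [← integral_sub (integrable_lipschitz_comp_re hf hpint)
      (integrable_lipschitz_comp_re hf hSint)]
    calc |∫ z, (f (p z).re - f (fourierSeriesL2 σ z).re) ∂μ|
        ≤ ∫ z, |f (p z).re - f (fourierSeriesL2 σ z).re| ∂μ := abs_integral_le_integral_abs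
      _ ≤ ∫ z, K * ‖(ContinuousMap.toLp (E := ℂ) 2 μ ℂ p - fourierSeriesL2 σ :
            Lp ℂ 2 μ) z‖ ∂μ := by
          refine integral_mono_ae (((integrable_lipschitz_comp_re hf hpint).sub
            (integrable_lipschitz_comp_re hf hSint)).abs)
            ((integrable_Lp_two_haarAddCircle _).norm.const_mul K) ?_
          filter_upwards [Lp.coeFn_sub (ContinuousMap.toLp (E := ℂ) 2 μ ℂ p) (fourierSeriesL2 σ),
            ContinuousMap.coeFn_toLp (E := ℂ) (p := 2) (𝕜 := ℂ) μ p] with z h1 h2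
          rw [h1, Pi.sub_apply, h2]
          refine (hf _ _).trans (mul_le_mul_of_nonneg_left ?_ hK)
          rw [← Complex.sub_re]
          exact Complex.abs_re_le_norm _
      _ ≤ K * η := by
          rw [integral_const_mul]
          exact mul_le_mul_of_nonneg_left ((integral_norm_le_norm_Lp_two _).trans hA1) hK
  have hlarge : ∀ᶠ N : ℕ in atTop, 4 * M * C ^ 2 ≤ 2 * η ^ 2 * N := by
    have : Tendsto (fun N : ℕ => 2 * η ^ 2 * (N : ℝ)) atTop atTop :=
      tendsto_natCast_atTop_atTop.const_mul_atTop (by positivity)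
    exact this.eventually_ge_atTop _
  filter_upwards [hR, hlarge, eventually_gt_atTop 0] with N hN1 hN2 hN0 W lam hW
  have hNpos : (0 : ℝ) < N := by exact_mod_cast hN0
  set T := toeplitzCov σ N with hT
  set T' := toeplitzCov (fun k => if k ∈ A then σ k else 0) N with hT'
  set U := (dftMatrix N).conjTranspose with hU
  have hUu : U ∈ Matrix.unitaryGroup (Fin N) ℂ :=
    Unitary.star_mem (dftMatrix_mem_unitaryGroup N)
  set b : Fin N → ℂ := fun j =>
    p ((2 * Real.pi * (j : ℕ) / N : ℝ) : AddCircle (2 * Real.pi)) with hb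
  have hF : ∑ i, ∑ j, ‖(T * U - U * Matrix.diagonal b) i j‖ ^ 2 ≤ 4 * η ^ 2 * N := by
    have h1 : ∑ i, ∑ j, ‖((T - T') * U) i j‖ ^ 2 ≤ N * η ^ 2 := by
      rw [sum_sum_norm_sq_mul_unitary hUu]
      exact (sum_sum_norm_sq_toeplitz_sub_le hσ A N).trans (by gcongr)
    have h2 : ∑ i, ∑ j, ‖(T' * U - U * Matrix.diagonal b) i j‖ ^ 2 ≤ 2 * M * C ^ 2 :=
      sum_sum_norm_sq_toeplitz_mul_dft_sub_le A hM N
    have h3 : ∑ i, ∑ j, ‖(T * U - U * Matrix.diagonal b) i j‖ ^ 2 ≤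
        ∑ i, ∑ j, (2 * ‖((T - T') * U) i j‖ ^ 2 +
          2 * ‖(T' * U - U * Matrix.diagonal b) i j‖ ^ 2) := by
      refine Finset.sum_le_sum fun i _ => Finset.sum_le_sum fun j _ => ?_
      have e : (T * U - U * Matrix.diagonal b) i j =
          ((T - T') * U) i j + (T' * U - U * Matrix.diagonal b) i j := by
        simp only [Matrix.sub_mul, Matrix.sub_apply]
        ring
      rw [e]
      nlinarith [norm_add_le (((T - T') * U) i j) ((T' * U - U * Matrix.diagonal b) i j),
        sq_nonneg (‖((T - T') * U) i j‖ - ‖(T' * U - U * Matrix.diagonal b) i j‖),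
        norm_nonneg (((T - T') * U) i j + (T' * U - U * Matrix.diagonal b) i j),
        norm_nonneg (((T - T') * U) i j), norm_nonneg ((T' * U - U * Matrix.diagonal b) i j)]
    simp_rw [Finset.sum_add_distrib, ← Finset.mul_sum] at h3
    linarith
  have h1 : |1 / (N : ℝ) * ∑ i, f (lam i) - 1 / (N : ℝ) * ∑ j, f (b j).re| ≤ K * (2 * η) := by
    rw [← mul_sub, abs_mul, abs_of_pos (by positivity)]
    have h2 := hW.abs_sum_sub_sum_le hUu b hK hf
    have h3 : Real.sqrt (N * ∑ i, ∑ j, ‖(T * U - U * Matrix.diagonal b) i j‖ ^ 2) ≤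
        2 * η * N := by
      refine Real.sqrt_le_iff.2 ⟨by positivity, ?_⟩
      calc _ ≤ (N : ℝ) * (4 * η ^ 2 * N) := by gcongr
        _ = _ := by ring
    calc 1 / (N : ℝ) * _ ≤ 1 / (N : ℝ) * (K * (2 * η * N)) := by
          gcongr
          exact h2.trans (by gcongr)
      _ = _ := by field_simp
  have h2 : |1 / (N : ℝ) * ∑ j, f (b j).re - ∫ z, f (p z).re ∂μ| ≤ η := by
    rw [integral_haarAddCircle_eq_intervalIntegral]
    exact hN1
  have h4 : ε = 4 * (K + 1) * η := by rw [hη]; field_simp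
  calc _ ≤ |1 / (N : ℝ) * ∑ i, f (lam i) - 1 / (N : ℝ) * ∑ j, f (b j).re| +
        |1 / (N : ℝ) * ∑ j, f (b j).re - ∫ z, f (p z).re ∂μ| +
        |∫ z, f (p z).re ∂μ - ∫ z, f (fourierSeriesL2 σ z).re ∂μ| := by
        refine (abs_sub_le _ (∫ z, f (p z).re ∂μ) _).trans ?_
        gcongr
        exact abs_sub_le _ _ _
    _ ≤ K * (2 * η) + η + K * η := by gcongr
    _ ≤ ε := by rw [h4]; nlinarith

/-- A positive essential infimum provides a positive essential lower bound. The essential infimum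
is the real supremum of all essential lower bounds, which is `0` if there are none; positivity
excludes this case. -/
theorem exists_pos_ae_le_of_spectralEssInf_pos (h : 0 < spectralEssInf σ) :
    ∃ δ : ℝ, 0 < δ ∧
      ∀ᵐ z ∂(@AddCircle.haarAddCircle (2 * Real.pi) _), δ ≤ (fourierSeriesL2 σ z).re := by
  have hne : {a : ℝ | ∀ᵐ ω ∂(volume.restrict (Set.Ioc 0 (2 * Real.pi))),
      a ≤ spectralDensity σ ω}.Nonempty := by
    by_contra hcon
    rw [Set.not_nonempty_iff_eq_empty] at hcon
    have : spectralEssInf σ = 0 := by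
      rw [spectralEssInf, essInf, liminf_eq]
      change sSup {a : ℝ | ∀ᵐ ω ∂(volume.restrict (Set.Ioc 0 (2 * Real.pi))),
        a ≤ spectralDensity σ ω} = 0
      rw [hcon, Real.sSup_empty]
    exact h.ne' this
  obtain ⟨δ, hδ, hδ0⟩ : ∃ δ ∈ {a : ℝ | ∀ᵐ ω ∂(volume.restrict (Set.Ioc 0 (2 * Real.pi))),
      a ≤ spectralDensity σ ω}, 0 < δ := by
    refine exists_lt_of_lt_csSup hne ?_
    rw [spectralEssInf, essInf, liminf_eq] at h
    exact h
  -- transfer from the interval `(0, 2π]` to the normalized Haar measure of the circle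
  refine ⟨δ, hδ0, ?_⟩
  have hmp := AddCircle.measurePreserving_mk (2 * Real.pi) 0
  rw [zero_add] at hmp
  have hmeas : MeasurableSet {z : AddCircle (2 * Real.pi) | δ ≤ (fourierSeriesL2 σ z).re} :=
    measurableSet_le measurable_const
      (Complex.measurable_re.comp (Lp.stronglyMeasurable (fourierSeriesL2 σ)).measurable)
  have h1 : ∀ᵐ z ∂(volume : Measure (AddCircle (2 * Real.pi))), δ ≤ (fourierSeriesL2 σ z).re := by
    rw [← hmp.map_eq, ae_map_iff hmp.measurable.aemeasurable hmeas]
    exact hδ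
  rw [AddCircle.volume_eq_smul_haarAddCircle] at h1
  exact (Measure.ae_ennreal_smul_measure_iff (by simpa using Real.pi_pos)).1 h1

theorem abs_one_div_sqrt_max_sub_le {δ : ℝ} (hδ : 0 < δ) (x y : ℝ) :
    |1 / Real.sqrt (max x δ) - 1 / Real.sqrt (max y δ)| ≤
      1 / (δ * Real.sqrt δ) * |x - y| := by
  set a := max x δ with ha
  set b := max y δ with hb
  have haδ : δ ≤ a := le_max_right _ _
  have hbδ : δ ≤ b := le_max_right _ _
  have hs : 0 < Real.sqrt δ := Real.sqrt_pos.2 hδ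
  have hsa : Real.sqrt δ ≤ Real.sqrt a := Real.sqrt_le_sqrt haδ
  have hsb : Real.sqrt δ ≤ Real.sqrt b := Real.sqrt_le_sqrt hbδ
  have hsa0 := hs.trans_le hsa
  have hsb0 := hs.trans_le hsb
  have hab : |b - a| ≤ |x - y| := by
    rw [abs_sub_comm]
    exact abs_max_sub_max_le_abs x y δ
  have e : 1 / Real.sqrt a - 1 / Real.sqrt b =
      (b - a) / (Real.sqrt a * Real.sqrt b * (Real.sqrt a + Real.sqrt b)) := by
    have h1 : b - a = (Real.sqrt b - Real.sqrt a) * (Real.sqrt a + Real.sqrt b) := by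
      nlinarith [Real.mul_self_sqrt (hδ.le.trans haδ), Real.mul_self_sqrt (hδ.le.trans hbδ)]
    rw [h1]
    field_simp
  have hden : δ * Real.sqrt δ ≤ Real.sqrt a * Real.sqrt b * (Real.sqrt a + Real.sqrt b) := by
    have h1 : δ ≤ Real.sqrt a * Real.sqrt b := by
      calc δ = Real.sqrt δ * Real.sqrt δ := (Real.mul_self_sqrt hδ.le).symm
        _ ≤ _ := by gcongr
    have h2 : Real.sqrt δ ≤ Real.sqrt a + Real.sqrt b := by linarith
    gcongr
  have hD : 0 < Real.sqrt a * Real.sqrt b * (Real.sqrt a + Real.sqrt b) := by positivity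
  rw [e, abs_div, abs_of_pos hD, one_div_mul_eq_div]
  gcongr

theorem one_div_sqrt_max_eq_rpow {δ x : ℝ} (hδ : 0 < δ) (hx : δ ≤ x) :
    1 / Real.sqrt (max x δ) = x ^ (-(1 / 2) : ℝ) := by
  rw [max_eq_left hx, Real.sqrt_eq_rpow, Real.rpow_neg (hδ.le.trans hx), one_div]

/-- The average of `λ^{-1/2}` over the spectra of the Toeplitz matrices converges to
`spectralLambda σ`. -/
theorem tendsto_average_rpow_neg_half (hσ : Summable fun k => ‖σ k‖ ^ 2)
    (hinf : 0 < spectralEssInf σ) {Nt : ℕ → ℕ} (hNt : Tendsto Nt atTop atTop)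
    {W : ∀ n, Matrix (Fin (Nt n)) (Fin (Nt n)) ℂ} {lam : ∀ n, Fin (Nt n) → ℝ}
    (hW : ∀ n, IsEigenDecomp (toeplitzCov σ (Nt n)) (W n) (lam n)) :
    Tendsto (fun n => 1 / (Nt n : ℝ) * ∑ i, lam n i ^ (-(1 / 2) : ℝ)) atTop
      (𝓝 (spectralLambda σ)) := by
  obtain ⟨δ, hδ0, hδ⟩ := exists_pos_ae_le_of_spectralEssInf_pos hinf
  have hΛ : spectralLambda σ = ∫ z, 1 / Real.sqrt (max (fourierSeriesL2 σ z).re δ)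
      ∂(@AddCircle.haarAddCircle (2 * Real.pi) _) := by
    have h1 : ∫ z, 1 / Real.sqrt (max (fourierSeriesL2 σ z).re δ)
        ∂(@AddCircle.haarAddCircle (2 * Real.pi) _) =
        ∫ z, 1 / Real.sqrt (fourierSeriesL2 σ z).re
        ∂(@AddCircle.haarAddCircle (2 * Real.pi) _) := by
      refine integral_congr_ae ?_
      filter_upwards [hδ] with z hz
      rw [max_eq_left hz]
    rw [h1, integral_haarAddCircle_eq_intervalIntegral]
    rfl
  rw [hΛ, Metric.tendsto_atTop]
  intro ε hε
  have h := eventually_abs_average_eigenvalues_sub_le hσ (f := fun x => 1 / Real.sqrt (max x δ))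
    (K := 1 / (δ * Real.sqrt δ)) (by positivity) (abs_one_div_sqrt_max_sub_le hδ0)
    (ε := ε / 2) (by positivity)
  obtain ⟨n₀, hn₀⟩ := eventually_atTop.1 (hNt.eventually h)
  refine ⟨n₀, fun n hn => ?_⟩
  have h1 := hn₀ n hn (W n) (lam n) (hW n)
  rw [Finset.sum_congr rfl fun i _ => one_div_sqrt_max_eq_rpow hδ0
    (le_of_isEigenDecomp_toeplitzCov hσ hδ (hW n) i)] at h1
  rw [Real.dist_eq]
  linarith

theorem spectralLambda_pos (hinf : 0 < spectralEssInf σ) : 0 < spectralLambda σ := by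
  obtain ⟨δ, hδ0, hδ⟩ := exists_pos_ae_le_of_spectralEssInf_pos hinf
  have h1 : spectralLambda σ = ∫ z, 1 / Real.sqrt (fourierSeriesL2 σ z).re
      ∂(@AddCircle.haarAddCircle (2 * Real.pi) _) := by
    rw [integral_haarAddCircle_eq_intervalIntegral]
    rfl
  have hint : Integrable (fun z => 1 / Real.sqrt (fourierSeriesL2 σ z).re)
      (@AddCircle.haarAddCircle (2 * Real.pi) _) := by
    refine Integrable.congr (f := fun z => 1 / Real.sqrt (max (fourierSeriesL2 σ z).re δ))
      (integrable_lipschitz_comp_re (abs_one_div_sqrt_max_sub_le hδ0)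
        (integrable_Lp_two_haarAddCircle (fourierSeriesL2 σ))) ?_
    filter_upwards [hδ] with z hz
    rw [max_eq_left hz]
  rw [h1, integral_pos_iff_support_of_nonneg (fun z => by positivity) hint]
  have h2 : ∀ᵐ z ∂(@AddCircle.haarAddCircle (2 * Real.pi) _),
      z ∈ Function.support fun z => 1 / Real.sqrt (fourierSeriesL2 σ z).re := by
    filter_upwards [hδ] with z hz
    have : 0 < Real.sqrt (fourierSeriesL2 σ z).re := Real.sqrt_pos.2 (hδ0.trans_le hz)
    rw [Function.mem_support]
    positivity
  have h3 : (Function.support fun z => 1 / Real.sqrt (fourierSeriesL2 σ z).re) =ᵐ[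
      (@AddCircle.haarAddCircle (2 * Real.pi) _)] Set.univ := eventuallyEq_univ.2 h2
  rw [measure_congr h3]
  simp

end SzegoLimit

/-! ### Reduction of the zero-forcing SNR to a white channel -/

section Reduction

/-- Every unit vector is a row of a unitary matrix. -/
theorem exists_mem_unitaryGroup_row_eq {N : ℕ} (k : Fin N) (x : Fin N → ℂ)
    (hx : ∑ j, ‖x j‖ ^ 2 = 1) : ∃ Q ∈ Matrix.unitaryGroup (Fin N) ℂ, Q k = x := by
  have hx' : ‖(WithLp.toLp 2 x : EuclideanSpace ℂ (Fin N))‖ = 1 := by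
    rw [EuclideanSpace.norm_eq, ← Real.sqrt_one]
    exact congrArg _ hx
  obtain ⟨b, hb⟩ := Orthonormal.exists_orthonormalBasis_extension_of_card_eq (𝕜 := ℂ)
    (E := EuclideanSpace ℂ (Fin N)) (ι := Fin N) (by simp)
    (v := fun _ => WithLp.toLp 2 x) (s := {k})
    ⟨fun _ => hx', fun i j hij => absurd (Subsingleton.elim i j) hij⟩
  refine ⟨Matrix.of fun i j => b i j, ?_, ?_⟩
  · rw [Matrix.mem_unitaryGroup_iff]
    ext i j
    have h := (orthonormal_iff_ite.1 b.orthonormal) j i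
    rw [EuclideanSpace.inner_eq_star_dotProduct] at h
    simp only [Matrix.mul_apply, Matrix.star_apply, Matrix.of_apply, Matrix.one_apply]
    rw [if_congr (eq_comm (a := i)) rfl rfl, ← h]
    rfl
  · ext j
    simp [hb k rfl]

/-- A change of basis `T` whose `k`-th row is a multiple of the `k`-th unit vector scales the
`k`-th diagonal entry of the inverse Gram matrix. -/
theorem inv_gram_mul_apply_of_row_eq {N R : ℕ} {F M T : Matrix (Fin N) (Fin N) ℂ} {k : Fin N}
    {t : ℝ} (hM : F * T = M) (hT : IsUnit T) (hk : T k = Pi.single k (t : ℂ))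
    (H : Matrix (Fin R) (Fin N) ℂ) :
    (F.conjTranspose * H.conjTranspose * H * F)⁻¹ k k =
      t ^ 2 * ((H * M).conjTranspose * (H * M))⁻¹ k k := by
  have hTd : IsUnit T.det := (Matrix.isUnit_iff_isUnit_det T).1 hT
  have hF : F = M * T⁻¹ := by rw [← hM, Matrix.mul_nonsing_inv_cancel_right _ _ hTd]
  have h1 : F.conjTranspose * H.conjTranspose * H * F =
      (T⁻¹).conjTranspose * ((H * M).conjTranspose * (H * M)) * T⁻¹ := by
    rw [hF]
    simp only [Matrix.conjTranspose_mul, Matrix.mul_assoc]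
  rw [h1, Matrix.mul_inv_rev, Matrix.mul_inv_rev, ← Matrix.conjTranspose_nonsing_inv,
    Matrix.nonsing_inv_nonsing_inv _ hTd]
  set X := ((H * M).conjTranspose * (H * M))⁻¹
  simp only [Matrix.mul_apply, Matrix.conjTranspose_apply, hk]
  rw [Finset.sum_eq_single k (by intro b _ hb; simp [hb]) (by simp),
    Finset.sum_eq_single k (by intro b _ hb; simp [hb]) (by simp)]
  simp
  ring

/-- The precoder equals, up to the invertible factor of `inv_gram_mul_apply_of_row_eq`, a matrix
`M` that whitens the covariance `S`. The DFT matrix has entries of constant modulus, so the scaling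
factor is the same for every sub-channel `k`. -/
theorem exists_whitening_optimalPrecoder {N : ℕ} {S W : Matrix (Fin N) (Fin N) ℂ}
    {lam : Fin N → ℝ} (hW : IsEigenDecomp S W lam) (hlam : ∀ i, 0 < lam i) (v : ℝ) (k : Fin N) :
    ∃ M : Matrix (Fin N) (Fin N) ℂ, M.conjTranspose * S * M = 1 ∧
      ∀ {R : ℕ} (H : Matrix (Fin R) (Fin N) ℂ), zfSNR v H (optimalPrecoder W lam) k =
        1 / v * N / (∑ i, lam i ^ (-(1 / 2) : ℝ)) ^ 2 *
          invGramDiag k (fun j r => (H * M) r j) := by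
  have hN : (0 : ℝ) < N := by exact_mod_cast k.pos
  set s := ∑ i, lam i ^ (-(1 / 2) : ℝ) with hs
  have hs0 : 0 < s := Finset.sum_pos (fun i _ => Real.rpow_pos_of_pos (hlam i) _) ⟨k, Finset.mem_univ k⟩
  set V := dftMatrix N with hV
  set D : Matrix (Fin N) (Fin N) ℂ :=
    Matrix.diagonal (fun i => ((lam i ^ (-(1 / 4) : ℝ) : ℝ) : ℂ)) with hD
  have hDsq : ∀ i, (lam i ^ (-(1 / 4) : ℝ)) ^ 2 = lam i ^ (-(1 / 2) : ℝ) := fun i => by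
    rw [← Real.rpow_natCast, ← Real.rpow_mul (hlam i).le]
    norm_num
  have hVu : V * V.conjTranspose = 1 := Matrix.mem_unitaryGroup_iff.1 (dftMatrix_mem_unitaryGroup N)
  have hWu : W.conjTranspose * W = 1 := Matrix.mem_unitaryGroup_iff'.1 hW.unitary
  -- the normalization of row `k` of `Vᴴ D`, whose entries have squared modulus `lam j ^ (-1/2) / N`
  obtain ⟨Q, hQ, hQk⟩ := exists_mem_unitaryGroup_row_eq k
    (fun j => star (V j k) * (lam j ^ (-(1 / 4) : ℝ) : ℝ) * (√N / √s : ℝ)) (by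
      simp_rw [norm_mul, norm_star, mul_pow, hV, norm_dftMatrix_apply_sq, Complex.norm_real,
        Real.norm_eq_abs, sq_abs, hDsq, div_pow, Real.sq_sqrt hN.le, Real.sq_sqrt hs0.le]
      rw [← Finset.sum_mul, ← Finset.mul_sum, ← hs]
      field_simp)
  have hQu : Q * Q.conjTranspose = 1 := Matrix.mem_unitaryGroup_iff.1 hQ
  -- the inverse of the factor `(√s)⁻¹ D⁻¹ V` of the precoder, times a unitary matrix
  set T : Matrix (Fin N) (Fin N) ℂ := ((√s : ℝ) : ℂ) • (V.conjTranspose * D * Q.conjTranspose)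
    with hT
  have hD0 : ∀ i, ((lam i ^ (-(1 / 4) : ℝ) : ℝ) : ℂ) ≠ 0 := fun i =>
    Complex.ofReal_ne_zero.2 (Real.rpow_pos_of_pos (hlam i) _).ne'
  have hTunit : IsUnit T := by
    rw [Matrix.isUnit_iff_isUnit_det, hT, Matrix.det_smul, Matrix.det_mul, Matrix.det_mul,
      hD, Matrix.det_diagonal, isUnit_iff_ne_zero]
    have h1 : V.conjTranspose.det ≠ 0 := right_ne_zero_of_mul (a := V.det) (by
      rw [← Matrix.det_mul, hVu]; simp)
    have h2 : Q.conjTranspose.det ≠ 0 := right_ne_zero_of_mul (a := Q.det) (by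
      rw [← Matrix.det_mul, hQu]; simp)
    have h3 : ((√s : ℝ) : ℂ) ≠ 0 := Complex.ofReal_ne_zero.2 (Real.sqrt_pos.2 hs0).ne'
    exact mul_ne_zero (pow_ne_zero _ h3)
      (mul_ne_zero (mul_ne_zero h1 (Finset.prod_ne_zero_iff.2 fun i _ => hD0 i)) h2)
  have hrow : T k = Pi.single k ((s / √N : ℝ) : ℂ) := by
    ext j
    have h1 : ∀ a, star (V a k) * ((lam a ^ (-(1 / 4) : ℝ) : ℝ) : ℂ) =
        ((√s / √N : ℝ) : ℂ) * Q k a := fun a => by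
      have h2 : ((√s / √N : ℝ) : ℂ) * ((√N / √s : ℝ) : ℂ) = 1 := by
        rw [← Complex.ofReal_mul, ← Complex.ofReal_one]
        congr 1
        have := (Real.sqrt_pos.2 hs0).ne'
        have := (Real.sqrt_pos.2 hN).ne'
        field_simp
      rw [hQk, mul_comm _ (star (V a k) * _ * _), mul_assoc, mul_comm ((√N / √s : ℝ) : ℂ), h2,
        mul_one]
    have h3 : (V.conjTranspose * D * Q.conjTranspose) k j =
        ((√s / √N : ℝ) : ℂ) * (Q * Q.conjTranspose) k j := by
      rw [Matrix.mul_apply, Matrix.mul_apply, Finset.mul_sum]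
      refine Finset.sum_congr rfl fun a _ => ?_
      rw [hD, Matrix.mul_diagonal, Matrix.conjTranspose_apply, h1, mul_assoc]
    rw [hT, Matrix.smul_apply, h3, hQu, smul_eq_mul, ← mul_assoc, ← Complex.ofReal_mul, ← mul_div_assoc,
      Real.mul_self_sqrt hs0.le, Matrix.one_apply, Pi.single_apply, mul_ite, mul_one, mul_zero,
      if_congr (eq_comm (a := k)) rfl rfl]
  set M := W * (D * D) * Q.conjTranspose with hM
  have hFT : optimalPrecoder W lam * T = M := by
    have h1 : ((1 / √s : ℝ) : ℂ) * ((√s : ℝ) : ℂ) = 1 := by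
      rw [← Complex.ofReal_mul, one_div_mul_cancel (Real.sqrt_pos.2 hs0).ne', Complex.ofReal_one]
    rw [optimalPrecoder, hT, Matrix.smul_mul, Matrix.mul_smul, smul_smul, ← hs, h1, one_smul, hM]
    simp only [← hD, ← hV]
    calc W * D * V * (V.conjTranspose * D * Q.conjTranspose)
        = W * D * (V * V.conjTranspose) * D * Q.conjTranspose := by simp only [Matrix.mul_assoc]
      _ = _ := by rw [hVu, Matrix.mul_one]; simp only [Matrix.mul_assoc]
  refine ⟨M, ?_, fun {R} H => ?_⟩
  · have hDH : D.conjTranspose = D := by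
      rw [hD, Matrix.diagonal_conjTranspose]
      congr 1
      ext i
      exact Complex.conj_ofReal _
    have hDD : D * D * Matrix.diagonal (fun i => (lam i : ℂ)) * (D * D) = 1 := by
      simp only [hD, Matrix.diagonal_mul_diagonal]
      rw [← Matrix.diagonal_one]
      congr 1
      ext i
      rw [← Complex.ofReal_mul, ← Complex.ofReal_mul, ← Complex.ofReal_mul, ← pow_two, hDsq,
        Complex.ofReal_eq_one]
      have h1 : lam i ^ (-(1 / 2) : ℝ) * lam i ^ (-(1 / 2) : ℝ) = (lam i)⁻¹ := by
        rw [← Real.rpow_add (hlam i), ← Real.rpow_neg_one]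
        norm_num
      rw [mul_right_comm, h1, inv_mul_cancel₀ (hlam i).ne']
    rw [hM, hW.eq]
    simp only [Matrix.conjTranspose_mul, Matrix.conjTranspose_conjTranspose, hDH]
    calc Q * (D * D * W.conjTranspose) * (W * Matrix.diagonal (fun i => (lam i : ℂ)) *
          W.conjTranspose) * (W * (D * D) * Q.conjTranspose)
        = Q * (D * D * (W.conjTranspose * W) * Matrix.diagonal (fun i => (lam i : ℂ)) *
          (W.conjTranspose * W) * (D * D)) * Q.conjTranspose := by simp only [Matrix.mul_assoc]
      _ = 1 := by rw [hWu, Matrix.mul_one, Matrix.mul_one, hDD, Matrix.mul_one, hQu]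
  · have hgram : Matrix.gram ℂ (fun j => WithLp.toLp 2 (fun r => (H * M) r j)) =
        (H * M).conjTranspose * (H * M) := by
      ext i j
      rw [Matrix.gram_apply, EuclideanSpace.inner_eq_star_dotProduct, Matrix.mul_apply]
      simp only [dotProduct, Matrix.conjTranspose_apply, Pi.star_apply]
      exact Finset.sum_congr rfl fun _ _ => mul_comm _ _
    rw [zfSNR, inv_gram_mul_apply_of_row_eq hFT hTunit hrow, invGramDiag, hgram,
      ← Complex.ofReal_pow, Complex.re_ofReal_mul, div_pow, Real.sq_sqrt hN.le]
    simp only [mul_inv, div_eq_mul_inv, inv_inv]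
    ring

/-- Whitening turns a correlated Gaussian channel into one with independent standard entries. -/
theorem IsGaussianChannel.hasLaw_mul {Ω : Type*} [MeasurableSpace Ω] {P : Measure Ω} {R N : ℕ}
    {S : Matrix (Fin N) (Fin N) ℂ} {H : Ω → Matrix (Fin R) (Fin N) ℂ}
    (hH : IsGaussianChannel P S H) {M : Matrix (Fin N) (Fin N) ℂ}
    (hM : M.conjTranspose * S * M = 1) :
    HasLaw (fun ω (j : Fin N) (r : Fin R) => (H ω * M) r j)
      (Measure.pi fun _ => Measure.pi fun _ => stdComplexGaussian) P := by
  have h1 := hH.isCircularGaussian.linear_image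
    (fun (p : Fin N × Fin R) (q : Fin R × Fin N) => if q.1 = p.2 then M q.2 p.1 else 0)
  have hcov : (fun k l : Fin N × Fin R => ∑ i : Fin R × Fin N, ∑ j : Fin R × Fin N,
      star (if i.1 = k.2 then M i.2 k.1 else 0) * (if j.1 = l.2 then M j.2 l.1 else 0) *
        (if i.1 = j.1 then S i.2 j.2 else 0)) = fun k l => if k = l then 1 else 0 := by
    ext ⟨a, r⟩ ⟨b, r'⟩
    simp only [Fintype.sum_prod_type]
    have h2 := congrFun (congrFun hM a) b
    simp only [Matrix.mul_apply, Matrix.conjTranspose_apply, Finset.sum_mul,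
      Matrix.one_apply] at h2
    rw [Finset.sum_eq_single r (by intro x _ hx; simp [hx]) (by simp)]
    simp only [if_true]
    have h3 : ∀ x : Fin N, ∑ x' : Fin R, ∑ y : Fin N, star (M x a) *
        (if x' = r' then M y b else 0) * (if r = x' then S x y else 0) =
        if r = r' then ∑ y : Fin N, star (M x a) * S x y * M y b else 0 := by
      intro x
      rw [Finset.sum_eq_single r' (by intro z _ hz; simp [hz]) (by simp)]
      by_cases h : r = r'
      · simp only [h, if_true]
        exact Finset.sum_congr rfl fun y _ => by ring
      · simp [h]
    simp_rw [h3]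
    rw [Finset.sum_comm] at h2
    by_cases h : r = r'
    · simp only [h, if_true, Prod.mk.injEq, and_true]
      exact h2
    · simp [h]
  rw [hcov] at h1
  have h4 := h1.hasLaw_pi
  have hcurry : HasLaw (MeasurableEquiv.curry (Fin N) (Fin R) ℂ)
      (Measure.pi fun _ : Fin N => Measure.pi fun _ : Fin R => stdComplexGaussian)
      (Measure.pi fun _ : Fin N × Fin R => stdComplexGaussian) := by
    refine ⟨(MeasurableEquiv.curry (Fin N) (Fin R) ℂ).measurable.aemeasurable, ?_⟩
    have := Measure.infinitePi_map_curry (fun (_ : Fin N) (_ : Fin R) => stdComplexGaussian)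
    simpa only [Measure.infinitePi_eq_pi] using this
  have h5 := hcurry.comp h4
  convert h5 using 1
  ext ω j r
  simp only [MeasurableEquiv.curry, Function.comp_apply, MeasurableEquiv.coe_mk, Equiv.curry_apply,
    Function.curry_apply, Fintype.sum_prod_type]
  rw [Finset.sum_eq_single r (by intro x _ hx; simp [hx]) (by simp), Matrix.mul_apply]
  exact Finset.sum_congr rfl fun i _ => by simp [mul_comm]

/-- The zero-forcing SNR is a deterministic multiple of a Gamma variable. -/
theorem IsGaussianChannel.exists_zfSNR_eq_mul {Ω : Type*} [MeasurableSpace Ω] {P : Measure Ω}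
    {R N d : ℕ} {S W : Matrix (Fin N) (Fin N) ℂ} {H : Ω → Matrix (Fin R) (Fin N) ℂ}
    (hH : IsGaussianChannel P S H) {lam : Fin N → ℝ} (hW : IsEigenDecomp S W lam)
    (hlam : ∀ i, 0 < lam i) (v : ℝ) (k : Fin N) (hd : N + d = R + 1) :
    ∃ Y : Ω → ℝ, HasLaw Y (complexChiSq d) P ∧ ∀ ω, zfSNR v (H ω) (optimalPrecoder W lam) k =
      1 / v * N / (∑ i, lam i ^ (-(1 / 2) : ℝ)) ^ 2 * Y ω := by
  obtain ⟨M, hM, hzf⟩ := exists_whitening_optimalPrecoder hW hlam v k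
  refine ⟨fun ω => invGramDiag k (fun j r => (H ω * M) r j), ?_, fun ω => hzf (H ω)⟩
  have h1 := hH.hasLaw_mul hM
  cases N with
  | zero => exact k.elim0
  | succ n => exact (hasLaw_invGramDiag (by omega) k).comp h1

end Reduction

/-! ### Concentration -/

section Concentration

variable {Ω : Type*} [MeasurableSpace Ω] {P : Measure Ω}

/-- Summable fourth moments force almost sure convergence to zero, whatever the joint law. -/
theorem ae_tendsto_zero_of_summable_integral_pow_four {X : ℕ → Ω → ℝ}
    (hX : ∀ n, Integrable (fun ω => X n ω ^ 4) P) (hs : Summable fun n => ∫ ω, X n ω ^ 4 ∂P) :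
    ∀ᵐ ω ∂P, Tendsto (fun n => X n ω) atTop (𝓝 0) := by
  have hm : ∀ n, AEMeasurable (fun ω => ENNReal.ofReal (X n ω ^ 4)) P := fun n =>
    (hX n).aemeasurable.ennreal_ofReal
  have hnn : ∀ n ω, 0 ≤ X n ω ^ 4 := fun n ω => by positivity
  have h1 : ∫⁻ ω, ∑' n, ENNReal.ofReal (X n ω ^ 4) ∂P ≠ ⊤ := by
    rw [lintegral_tsum hm]
    simp_rw [← fun n => ofReal_integral_eq_lintegral_ofReal (hX n) (Eventually.of_forall (hnn n))]
    rw [← ENNReal.ofReal_tsum_of_nonneg (fun n => integral_nonneg (hnn n)) hs]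
    exact ENNReal.ofReal_ne_top
  filter_upwards [ae_lt_top' (AEMeasurable.tsum hm) h1] with ω hω
  have h2 := ENNReal.tendsto_atTop_zero_of_tsum_ne_top hω.ne
  have h3 : Tendsto (fun n => X n ω ^ 4) atTop (𝓝 0) := by
    have := (ENNReal.tendsto_toReal ENNReal.zero_ne_top).comp h2
    simpa [Function.comp_def, ENNReal.toReal_ofReal (hnn _ ω)] using this
  rw [tendsto_zero_iff_norm_tendsto_zero]
  have h4 : Tendsto (fun n => √(√(X n ω ^ 4))) atTop (𝓝 √(√0)) :=
    (Real.continuous_sqrt.comp Real.continuous_sqrt).continuousAt.tendsto.comp h3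
  have h5 : ∀ x : ℝ, √(√(x ^ 4)) = ‖x‖ := fun x => by
    rw [show x ^ 4 = (x ^ 2) ^ 2 by ring, Real.sqrt_sq (by positivity), Real.sqrt_sq_eq_abs,
      Real.norm_eq_abs]
  simpa [h5] using h4

/-- Scaled Gamma variables with strictly increasing shapes concentrate at the limit of their
means. -/
theorem tendsto_mul_of_hasLaw_complexChiSq [IsProbabilityMeasure P] {Y : ℕ → Ω → ℝ} {d : ℕ → ℕ}
    (hY : ∀ n, HasLaw (Y n) (complexChiSq (d n)) P) (hd : StrictMono d) {a : ℕ → ℝ} {ℓ : ℝ}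
    (ha : Tendsto (fun n => a n * d n) atTop (𝓝 ℓ)) :
    (∀ᵐ ω ∂P, Tendsto (fun n => a n * Y n ω) atTop (𝓝 ℓ)) ∧
    (∀ n, MemLp (fun ω => a n * Y n ω) 2 P) ∧
    Tendsto (fun n => ∫ ω, a n * Y n ω ∂P) atTop (𝓝 ℓ) ∧
    Tendsto (fun n => variance (fun ω => a n * Y n ω) P) atTop (𝓝 0) := by
  obtain ⟨C, hC0, hC⟩ := exists_moments_complexChiSq
  have hL4 : ∀ n, MemLp (Y n) 4 P := fun n => by
    have h := (hC (d n)).1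
    rw [← (hY n).map_eq, memLp_map_measure_iff aestronglyMeasurable_id (hY n).aemeasurable] at h
    exact h
  have hL2 : ∀ n, MemLp (Y n) 2 P := fun n => (hL4 n).mono_exponent (by norm_num)
  have hmean : ∀ n, ∫ ω, Y n ω ∂P = d n := fun n => by rw [(hY n).integral_eq, (hC _).2.1]
  have hmean' : ∀ n, ∫ ω, a n * Y n ω ∂P = a n * d n := fun n => by
    rw [integral_const_mul, hmean]
  have hpow : ∀ n (k : ℕ), ∫ ω, (a n * Y n ω - a n * d n) ^ k ∂P =
      a n ^ k * ∫ x, (x - d n) ^ k ∂complexChiSq (d n) := fun n k => by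
    rw [← (hY n).integral_comp (f := fun x => (x - d n) ^ k)
      (by fun_prop), ← integral_const_mul]
    refine integral_congr_ae (Eventually.of_forall fun ω => ?_)
    simp only [Function.comp_apply]
    rw [← mul_sub, mul_pow]
  -- the means `a n * d n` are bounded, so the fourth central moments are `O(1 / (d n)²)`
  obtain ⟨B, hB⟩ := (Metric.isBounded_range_of_tendsto _ ha).exists_norm_le
  have hB' : ∀ n, (a n * d n) ^ 4 ≤ B ^ 4 := fun n => by
    rw [← Even.pow_abs (by decide : Even 4)]
    exact pow_le_pow_left₀ (abs_nonneg _) (hB _ ⟨n, rfl⟩) 4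
  refine ⟨?_, fun n => (hL2 n).const_mul _, by simpa only [hmean'] using ha, ?_⟩
  · have h4 : ∀ n, ∫ ω, (a n * Y n ω - a n * d n) ^ 4 ∂P ≤ B ^ 4 * C * (1 / (d n : ℝ) ^ 2) := by
      intro n
      rw [hpow]
      have h1 : a n ^ 4 * (C * (d n : ℝ) ^ 2) = (a n * d n) ^ 4 * C * (1 / (d n : ℝ) ^ 2) := by
        rcases eq_or_ne (d n : ℝ) 0 with h | h
        · simp [h]
        · field_simp
      calc _ ≤ a n ^ 4 * (C * (d n : ℝ) ^ 2) := by gcongr; exact (hC (d n)).2.2.2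
        _ = _ := h1
        _ ≤ _ := by gcongr ?_ * _ * _; exact hB' n
    have hsum : Summable fun n => ∫ ω, (a n * Y n ω - a n * d n) ^ 4 ∂P := by
      refine Summable.of_nonneg_of_le (fun n => integral_nonneg fun ω => by positivity) h4 ?_
      exact ((Real.summable_one_div_nat_pow.2 one_lt_two).comp_injective hd.injective).mul_left _
    have hint : ∀ n, Integrable (fun ω => (a n * Y n ω - a n * d n) ^ 4) P := fun n =>
      MemLp.integrable_pow_of_le (p := 4)
        (((hL4 n).const_mul (a n)).sub (memLp_const (a n * d n))) le_rfl
    filter_upwards [ae_tendsto_zero_of_summable_integral_pow_four hint hsum] with ω hω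
    simpa using hω.add ha
  · have hvar : ∀ n, variance (fun ω => a n * Y n ω) P ≤ (a n * d n) ^ 2 * C * (1 / (d n : ℝ)) := by
      intro n
      rw [variance_eq_integral ((hY n).aemeasurable.const_mul _), hmean', hpow]
      have h1 : a n ^ 2 * (C * (d n : ℝ)) = (a n * d n) ^ 2 * C * (1 / (d n : ℝ)) := by
        rcases eq_or_ne (d n : ℝ) 0 with h | h
        · simp [h]
        · field_simp
      rw [← h1]
      gcongr
      exact (hC (d n)).2.2.1
    refine squeeze_zero (fun n => variance_nonneg _ _) hvar ?_
    have h2 : Tendsto (fun n => 1 / (d n : ℝ)) atTop (𝓝 0) :=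
      tendsto_one_div_atTop_nhds_zero_nat.comp hd.tendsto_atTop
    simpa using ((ha.pow 2).mul_const C).mul h2

end Concentration

theorem mainTheorem7 {Ω : Type*} [MeasurableSpace Ω] (P : Measure Ω) [IsProbabilityMeasure P]
    (σ : ℤ → ℂ) (hσ_herm : ∀ k, σ (-k) = star (σ k)) (hσ_sq : Summable fun k => ‖σ k‖ ^ 2)
    (hσ_inf : 0 < spectralEssInf σ)
    (v η : ℝ) (hv : 0 < v) (hη : η = 1 / v)
    (β : ℝ) (hβ : 1 < β)
    (Nt Nr : ℕ → ℕ) (hNt_pos : ∀ n, 0 < Nt n) (hNt : StrictMono Nt)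
    (hNr : ∀ n, (Nr n : ℝ) = β * Nt n)
    (W : ∀ n, Matrix (Fin (Nt n)) (Fin (Nt n)) ℂ) (lam : ∀ n, Fin (Nt n) → ℝ)
    (hW : ∀ n, IsEigenDecomp (toeplitzCov σ (Nt n)) (W n) (lam n))
    (H : ∀ n, Ω → Matrix (Fin (Nr n)) (Fin (Nt n)) ℂ)
    (hH : ∀ n, IsGaussianChannel P (toeplitzCov σ (Nt n)) (H n))
    (k : ∀ n, Fin (Nt n)) (τ : ℕ → Ω → ℝ)
    (hτ : ∀ n ω, τ n ω = zfSNR v (H n ω) (optimalPrecoder (W n) (lam n)) (k n)) :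
    (∀ᵐ ω ∂P, Tendsto (fun n => τ n ω) atTop (𝓝 (η * (β - 1) / spectralLambda σ ^ 2))) ∧
    (∀ n, MemLp (τ n) 2 P) ∧
    Tendsto (fun n => ∫ ω, τ n ω ∂P) atTop (𝓝 (η * (β - 1) / spectralLambda σ ^ 2)) ∧
    Tendsto (fun n => variance (τ n) P) atTop (𝓝 0) := by

  have hN : ∀ n, (0 : ℝ) < Nt n := fun n => by exact_mod_cast hNt_pos n
  have hle : ∀ n, Nt n ≤ Nr n := fun n => by
    have : (Nt n : ℝ) ≤ Nr n := by rw [hNr]; nlinarith [hN n]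
    exact_mod_cast this
  have hNtop : Tendsto Nt atTop atTop := hNt.tendsto_atTop
  obtain ⟨δ, hδ0, hδ⟩ := exists_pos_ae_le_of_spectralEssInf_pos hσ_inf
  have hlam : ∀ n i, 0 < lam n i := fun n i =>
    hδ0.trans_le (le_of_isEigenDecomp_toeplitzCov hσ_sq hδ (hW n) i)
  -- the codimension of the span of `Nt n - 1` vectors in `ℂ^(Nr n)`
  set d : ℕ → ℕ := fun n => Nr n + 1 - Nt n with hd
  have hdR : ∀ n, (d n : ℝ) = (β - 1) * Nt n + 1 := fun n => by
    rw [hd, Nat.cast_sub (by have := hle n; omega)]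
    push_cast
    rw [hNr]
    ring
  have hdmono : StrictMono d := fun m n hmn => by
    have h1 : (Nt m : ℝ) < Nt n := by exact_mod_cast hNt hmn
    have h2 : (d m : ℝ) < d n := by rw [hdR, hdR]; nlinarith
    exact_mod_cast h2
  choose Y hY hτY using fun n => (hH n).exists_zfSNR_eq_mul (d := d n) (hW n) (hlam n) v (k n)
    (by have := hle n; simp only [hd]; omega)
  have hτ' : ∀ n, τ n = fun ω =>
      1 / v * Nt n / (∑ i, lam n i ^ (-(1 / 2) : ℝ)) ^ 2 * Y n ω := fun n =>
    funext fun ω => (hτ n ω).trans (hτY n ω)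
  have havg := tendsto_average_rpow_neg_half hσ_sq hσ_inf hNtop hW
  have hlim : Tendsto (fun n => 1 / v * Nt n / (∑ i, lam n i ^ (-(1 / 2) : ℝ)) ^ 2 * d n) atTop
      (𝓝 (η * (β - 1) / spectralLambda σ ^ 2)) := by
    have h1 : Tendsto (fun n => 1 / (Nt n : ℝ)) atTop (𝓝 0) :=
      tendsto_one_div_atTop_nhds_zero_nat.comp hNtop
    have h2 := (((h1.const_add (β - 1)).const_mul η).div (havg.pow 2)
      (pow_ne_zero 2 (spectralLambda_pos hσ_inf).ne'))
    rw [add_zero] at h2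
    refine h2.congr fun n => ?_
    have hs : (∑ i, lam n i ^ (-(1 / 2) : ℝ)) ≠ 0 := (Finset.sum_pos
      (fun i _ => Real.rpow_pos_of_pos (hlam n i) _) ⟨k n, Finset.mem_univ _⟩).ne'
    have := (hN n).ne'
    rw [Pi.div_apply, hdR, hη]
    field_simp
  simp_rw [hτ']
  exact tendsto_mul_of_hasLaw_complexChiSq hY hdmono hlim
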